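/- Let $p$ be an odd prime and let $\mathcal A_p$ be the algebra of Steenrod $p$th powers $P^r$, $r\ge 0$ (no Bocksteins, $P^0=1$), that is, the algebra of operations on polynomials over $\mathbb F_p$ generated by the linear operators $P^r$ which satisfy the Cartan formula $P^r(fg)=\sum_{s+t=r}P^s f\cdot P^t g$ and, for each variable $x$ (of degree $1$), $P^1x=x^p$ and $P^rx=0$ for $r>1$. For a finite sequence $R=(r_1,\dots,r_m)$ of non-negative integers let $P(R)\in\mathcal A_p$ be the Milnor basis element dual to $\xi_1^{r_1}\cdots\xi_m^{r_m}$; thus $P(R)f$ is the coefficient of $\xi_1^{r_1}\cdots\xi_m^{r_m}$ in $\lambda(f)$, where $\lambda$ is the algebra homomorphism with $\lambda(x)=x+\sum_{i\ge1}x^{p^i}\xi_i$ for each variable $x$. Let $\chi$ be the canonical anti-automorphism of $\mathcal A_p$ (the antipode, so that $\sum_{i+j=r}P^i\chi(P^j)=0$ for $r>0$), put $\widehat P^r=(-1)^r\chi(P^r)$ and $p_n=(p^n-1)/(p-1)$, and let $P(p-1,\dots,p-1,b)$ denote the Milnor basis element of the sequence of length $n$ whose first $n-1$ entries are $p-1$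 and whose last entry is $b$. Let $1\le b\le p-1$. Then: (i) for $n\ge1$, the monomial $P^{(b+1)p^{n-1}-1}\cdots P^{(b+1)p-1}P^{b}$ is admissible (each exponent is positive and at least $p$ times the next one) and $$P(p-1,\dots,p-1,b)=P^{(b+1)p^{n-1}-1}\cdots P^{(b+1)p-1}P^{b};$$ (ii) for $n\ge1$, $\widehat P^{(b+1)p_n-n}\,g=P(p-1,\dots,p-1,b)\,g$ for every polynomial $g$ over $\mathbb F_p$ (in any number of variables) with $\deg g\le n(p-1)+b$; (iii) for $n\ge2$, $\widehat P^{(b+1)p_n-n}=P^{(b+1)p^{n-1}}\,\widehat P^{(b+1)p_{n-1}-n}+P(p-1,\dots,p-1,b)$ in $\mathcal A_p$. -/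

import Mathlib

namespace PthPowers

/-- The polynomial algebra `𝔽_p[x_0, x_1, x_2, …]`, each variable having degree one. It contains
the polynomial algebras in any finite number of variables. -/
abbrev Poly (p : ℕ) : Type := MvPolynomial ℕ (ZMod p)

/-- The total Steenrod power `∑ P^r T^r`. By the Cartan formula it is an algebra homomorphism to
polynomials in `T`; it sends `x_j` to `x_j + x_j ^ p T`. -/
noncomputable def totalPower (p : ℕ) : Poly p →ₐ[ZMod p] Polynomial (Poly p) :=
  MvPolynomial.aeval fun j =>
    Polynomial.C (MvPolynomial.X j) + Polynomial.C (MvPolynomial.X j ^ p) * Polynomial.X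

/-- The Steenrod power `P^r` as a linear operator on polynomials: `P^r f` is the coefficient of
`T^r` in the total power of `f`. -/
noncomputable def powerOp (p r : ℕ) : Module.End (ZMod p) (Poly p) :=
  (Polynomial.lcoeff (Poly p) r).restrictScalars (ZMod p) ∘ₗ (totalPower p).toLinearMap

/-- The algebra `𝒜_p` of Steenrod `p`th powers (no Bocksteins): the algebra of operations on
polynomials over `𝔽_p` that is generated by the `P^r`; the product is composition. -/
noncomputable def steenrodAlgebra (p : ℕ) : Subalgebra (ZMod p) (Module.End (ZMod p) (Poly p)) :=
  Algebra.adjoin (ZMod p) (Set.range (powerOp p))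

/-- The Steenrod power `P^r` as an element of `𝒜_p`. -/
noncomputable def P (p r : ℕ) : steenrodAlgebra p :=
  ⟨powerOp p r, Algebra.subset_adjoin (Set.mem_range_self r)⟩

theorem powerOp_apply (p r : ℕ) (f : Poly p) : powerOp p r f = (totalPower p f).coeff r := rfl

theorem powerOp_mul (p r : ℕ) (f g : Poly p) :
    powerOp p r (f * g) =
      ∑ ij ∈ Finset.HasAntidiagonal.antidiagonal r, powerOp p ij.1 f * powerOp p ij.2 g := by
  simp only [powerOp_apply, map_mul, Polynomial.coeff_mul]

theorem powerOp_zero (p : ℕ) : powerOp p 0 = 1 := by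
  refine LinearMap.ext fun f => ?_
  have h : ((Polynomial.aeval (0 : Poly p)).restrictScalars (ZMod p)).comp (totalPower p)
      = AlgHom.id (ZMod p) (Poly p) := by
    apply MvPolynomial.algHom_ext
    intro j
    simp [totalPower]
  have h2 := DFunLike.congr_fun h f
  simpa [powerOp_apply, Polynomial.coeff_zero_eq_aeval_zero] using h2

theorem prime_dvd_choose {p : ℕ} (hp : p.Prime) (N k r : ℕ) (hr : 0 < r)
    (h : k + r * (p - 1) + 1 = p ^ N) : p ∣ k.choose r := by
  have h2 := hp.two_le
  induction N generalizing k r with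
  | zero =>
    have : 0 < r * (p - 1) := Nat.mul_pos hr (by omega)
    simp at h; omega
  | succ N ih =>
    obtain ⟨q, rfl⟩ : ∃ q, p = q + 1 := ⟨p - 1, by omega⟩
    simp only [Nat.add_sub_cancel] at h ih
    by_cases hk : (q + 1) ∣ k + 1
    · obtain ⟨k', hk'⟩ := hk
      have hr' : (q + 1) ∣ r := by
        have h1 : (q + 1) ∣ r * q := by
          refine (Nat.dvd_add_right (Dvd.intro k' hk'.symm)).1 ?_
          rw [show k + 1 + r * q = (q + 1) ^ (N + 1) by rw [← h]; ring]
          exact dvd_pow_self _ (by omega)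
        refine (Nat.Coprime.dvd_mul_right ?_).1 h1
        simp
      obtain ⟨r', rfl⟩ := hr'
      obtain ⟨l, rfl⟩ : ∃ l, k' = l + 1 := ⟨k' - 1, by
        have : k' ≠ 0 := by rintro rfl; simp at hk'
        omega⟩
      have hkl : k = q + (q + 1) * l := by
        have : k + 1 = (q + 1) * l + (q + 1) := by rw [hk']; ring
        omega
      have hr'' : 0 < r' := Nat.pos_of_mul_pos_left hr
      have hdvd := ih l r' hr'' (by
        have : (q + 1) * (l + r' * q + 1) = (q + 1) * (q + 1) ^ N := by
          rw [← pow_succ', ← h, hkl]; ring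
        exact Nat.eq_of_mul_eq_mul_left (by omega) this)
      have := Fact.mk hp
      have lucas := Choose.choose_modEq_choose_mod_mul_choose_div_nat (n := k) (k := (q + 1) * r')
        (p := q + 1)
      have e1 : k / (q + 1) = l := by
        rw [hkl, Nat.add_mul_div_left _ _ (by omega), Nat.div_eq_of_lt (by omega)]; simp
      rw [e1, Nat.mul_div_cancel_left _ (by omega)] at lucas
      exact (Nat.modEq_zero_iff_dvd).1 (lucas.trans
        (Nat.modEq_zero_iff_dvd.2 (hdvd.mul_left _)))
    · have hkr : k + 1 - r + (q + 1) * r = (q + 1) ^ (N + 1) ∨ k < r := by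
        by_cases hlt : k < r
        · exact Or.inr hlt
        · left
          have : (q + 1) * r = r * q + r := by ring
          omega
      rcases hkr with hkr | hkr
      · have hd : (q + 1) ∣ k + 1 - r := by
          refine (Nat.dvd_add_left (Dvd.intro r rfl)).1 ?_
          rw [hkr]
          exact dvd_pow_self _ (by omega)
        have := Nat.choose_mul_succ_eq k r
        have hd2 : (q + 1) ∣ k.choose r * (k + 1) := by
          rw [this]; exact hd.mul_left _
        exact (hp.dvd_mul.1 hd2).resolve_right hk
      · simp [Nat.choose_eq_zero_of_lt hkr]

/-- The exponents `e` all of whose entries are of the form `p ^ N - 1`. -/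
def IsTop (p : ℕ) (e : ℕ →₀ ℕ) : Prop := ∀ j, ∃ N, e j + 1 = p ^ N

theorem coeff_factor_pow (p j n i : ℕ) (hp : 0 < p) :
    ((Polynomial.C (MvPolynomial.X j : Poly p) +
      Polynomial.C (MvPolynomial.X j ^ p) * Polynomial.X) ^ n).coeff i =
      MvPolynomial.monomial (Finsupp.single j (n + i * (p - 1))) (n.choose i : ZMod p) := by
  have h : ∀ m ∈ Finset.range (n + 1),
      (Polynomial.C (MvPolynomial.X j ^ p : Poly p) * Polynomial.X) ^ m *
        Polynomial.C (MvPolynomial.X j : Poly p) ^ (n - m) * (n.choose m : Polynomial (Poly p)) =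
      Polynomial.C (MvPolynomial.monomial (Finsupp.single j (n + m * (p - 1)))
        (n.choose m : ZMod p)) * Polynomial.X ^ m := by
    intro m hm
    have hm' : m ≤ n := by simpa [Nat.lt_succ_iff] using hm
    have hexp : n + m * (p - 1) = p * m + (n - m) := by
      obtain ⟨q, rfl⟩ : ∃ q, p = q + 1 := ⟨p - 1, by omega⟩
      have : (q + 1) * m = m * q + m := by ring
      simp only [Nat.add_sub_cancel]; omega
    have e1 : (MvPolynomial.monomial (Finsupp.single j (n + m * (p - 1))) (n.choose m : ZMod p))
        = (n.choose m : Poly p) * MvPolynomial.X j ^ (n + m * (p - 1)) := by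
      rw [MvPolynomial.X_pow_eq_monomial, ← map_natCast (MvPolynomial.C (σ := ℕ)),
        MvPolynomial.C_mul_monomial, mul_one]
    rw [e1, hexp, pow_add, pow_mul, mul_pow]
    simp only [map_mul, map_pow, map_natCast]
    ring
  rw [add_comm, add_pow, Finset.sum_congr rfl h, Polynomial.finsetSum_coeff]
  simp only [Polynomial.coeff_C_mul_X_pow]
  rw [Finset.sum_ite_eq]
  split_ifs with hi
  · rfl
  · rw [Nat.choose_eq_zero_of_lt (by simpa [Nat.lt_succ_iff] using hi)]
    simp

theorem coeff_prod_factor (p : ℕ) (hp : 0 < p) (m : ℕ → ℕ) (s : Finset ℕ) :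
    ∀ (r : ℕ) (e : ℕ →₀ ℕ), MvPolynomial.coeff e ((∏ j ∈ s,
      (Polynomial.C (MvPolynomial.X j : Poly p) +
        Polynomial.C (MvPolynomial.X j ^ p) * Polynomial.X) ^ m j).coeff r) ≠ 0 →
      ∃ ρ : ℕ → ℕ, r = ∑ j ∈ s, ρ j ∧
        ∀ j ∈ s, e j = m j + ρ j * (p - 1) ∧ ((m j).choose (ρ j) : ZMod p) ≠ 0 := by
  suffices H : ∀ (r : ℕ) (e : ℕ →₀ ℕ), MvPolynomial.coeff e ((∏ j ∈ s,
      (Polynomial.C (MvPolynomial.X j : Poly p) +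
        Polynomial.C (MvPolynomial.X j ^ p) * Polynomial.X) ^ m j).coeff r) ≠ 0 →
      (∃ ρ : ℕ → ℕ, r = ∑ j ∈ s, ρ j ∧
        ∀ j ∈ s, e j = m j + ρ j * (p - 1) ∧ ((m j).choose (ρ j) : ZMod p) ≠ 0) ∧
      ∀ j ∉ s, e j = 0 from fun r e h => (H r e h).1
  induction s using Finset.induction_on with
  | empty =>
    intro r e h
    simp only [Finset.prod_empty, Polynomial.coeff_one] at h
    split_ifs at h with hr
    · subst hr
      have he : e = 0 := by
        by_contra hne
        exact h (by rw [MvPolynomial.coeff_one, if_neg (Ne.symm hne)])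
      subst he
      exact ⟨⟨0, by simp⟩, by simp⟩
    · simp at h
  | insert a s ha ih =>
    intro r e h
    rw [Finset.prod_insert ha, Polynomial.coeff_mul, MvPolynomial.coeff_sum] at h
    obtain ⟨⟨i, k⟩, hik, h⟩ := Finset.exists_ne_zero_of_sum_ne_zero h
    rw [MvPolynomial.coeff_mul] at h
    obtain ⟨⟨e1, e2⟩, he, h⟩ := Finset.exists_ne_zero_of_sum_ne_zero h
    rw [Finset.HasAntidiagonal.mem_antidiagonal] at hik he
    simp only at hik he h
    obtain ⟨h1, h2⟩ := ne_zero_and_ne_zero_of_mul h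
    obtain ⟨⟨ρ, hρ, hρ'⟩, hout⟩ := ih k e2 h2
    rw [coeff_factor_pow p a _ _ hp, MvPolynomial.coeff_monomial] at h1
    split_ifs at h1 with hs
    · subst hs
      refine ⟨⟨Function.update ρ a i, ?_, ?_⟩, ?_⟩
      · rw [Finset.sum_insert ha, Function.update_self, ← hik, hρ]
        congr 1
        refine Finset.sum_congr rfl fun j hj => ?_
        rw [Function.update_of_ne (fun hja => ha (by rw [← hja]; exact hj))]
      · intro j hj
        rcases Finset.mem_insert.1 hj with rfl | hj
        · simp [← he, hout j ha, h1]
        · have hne : j ≠ a := fun hja => ha (by rw [← hja]; exact hj)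
          rw [Function.update_of_ne hne, ← he, Finsupp.add_apply, Finsupp.single_eq_of_ne hne,
            zero_add]
          exact hρ' j hj
      · intro j hj
        rw [Finset.mem_insert, not_or] at hj
        rw [← he, Finsupp.add_apply, Finsupp.single_eq_of_ne hj.1, zero_add, hout j hj.2]
    · exact absurd rfl h1

theorem coeff_powerOp_top {p : ℕ} (hp : p.Prime) {e : ℕ →₀ ℕ} (he : IsTop p e) {r : ℕ}
    (hr : 0 < r) (f : Poly p) : MvPolynomial.coeff e (powerOp p r f) = 0 := by
  induction f using MvPolynomial.induction_on' with
  | add f g hf hg => rw [map_add, MvPolynomial.coeff_add, hf, hg, add_zero]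
  | monomial m c =>
    have hm : MvPolynomial.monomial m c = c • (MvPolynomial.monomial m (1 : ZMod p)) := by
      simp [MvPolynomial.smul_monomial]
    rw [hm, map_smul, MvPolynomial.coeff_smul]
    by_contra hne
    have hne' := right_ne_zero_of_smul hne
    rw [powerOp_apply, totalPower, MvPolynomial.aeval_monomial, map_one, one_mul,
      Finsupp.prod] at hne'
    obtain ⟨ρ, hρ, hρ'⟩ := coeff_prod_factor p hp.pos m m.support r e hne'
    obtain ⟨j, hj, hj'⟩ := Finset.exists_ne_zero_of_sum_ne_zero (hρ ▸ hr.ne')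
    obtain ⟨N, hN⟩ := he j
    obtain ⟨h1, h2⟩ := hρ' j hj
    refine h2 ((ZMod.natCast_eq_zero_iff _ _).2 (prime_dvd_choose hp N _ _ (Nat.pos_of_ne_zero hj') ?_))
    rw [← hN, h1]

/-- Auxiliary relation for the construction of the anti-automorphism: `T` and `T'` are adjoint
for the pairings `(f, g) ↦` coefficient of `x^e` in `f g`, where `e` runs over the exponents all of
whose entries are of the form `p ^ N - 1`. -/
def IsAdjoint (p : ℕ) (T T' : Module.End (ZMod p) (Poly p)) : Prop :=
  ∀ e, IsTop p e → ∀ f g, MvPolynomial.coeff e (T f * g) = MvPolynomial.coeff e (f * T' g)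

section Antipode

variable {p : ℕ} {S T S' T' : Module.End (ZMod p) (Poly p)}

theorem IsAdjoint.symm (h : IsAdjoint p T T') : IsAdjoint p T' T := fun e he f g => by
  rw [mul_comm, ← h e he, mul_comm]

theorem IsAdjoint.add (h : IsAdjoint p T T') (h' : IsAdjoint p S S') :
    IsAdjoint p (T + S) (T' + S') := fun e he f g => by
  simp [add_mul, mul_add, h e he f g, h' e he f g]

theorem IsAdjoint.mul (h : IsAdjoint p T T') (h' : IsAdjoint p S S') :
    IsAdjoint p (T * S) (S' * T') := fun e he f g => by
  simp [h e he, h' e he]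

theorem IsAdjoint.algebraMap (c : ZMod p) : IsAdjoint p (algebraMap _ _ c) (algebraMap _ _ c) :=
  fun e he f g => by
  simp [Module.algebraMap_end_apply]

theorem IsAdjoint.eq (hp : p.Prime) (h : IsAdjoint p T S) (h' : IsAdjoint p T S') : S = S' := by
  refine LinearMap.ext fun g => ?_
  by_contra hne
  have hne' : S g - S' g ≠ 0 := sub_ne_zero.2 hne
  obtain ⟨m, hm⟩ := MvPolynomial.ne_zero_iff.1 hne'
  let e : ℕ →₀ ℕ := m.mapRange (fun a => p ^ a - 1) (by simp)
  have hej : ∀ j, e j + 1 = p ^ m j := fun j => by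
    have := hp.one_lt.le
    have : 0 < p ^ m j := Nat.pow_pos (by omega)
    simp [e]; omega
  have hme : m ≤ e := fun j => by
    have := Nat.lt_pow_self (n := m j) hp.one_lt
    have := hej j
    omega
  have key : MvPolynomial.coeff e (MvPolynomial.monomial (e - m) (1 : ZMod p) * (S g - S' g)) = 0 := by
    rw [mul_sub, MvPolynomial.coeff_sub, ← h e (fun j => ⟨_, hej j⟩), ← h' e (fun j => ⟨_, hej j⟩),
      sub_self]
  apply hm
  rw [MvPolynomial.coeff_monomial_mul'] at key
  simpa [tsub_tsub_cancel_of_le hme] using key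


theorem IsAdjoint.zero : IsAdjoint p 0 0 := fun e he f g => by simp

/-- The elements `c_r` determined by `c_0 = 1` and `∑_{i + j = r} P^i c_j = 0` for `r > 0`. -/
noncomputable def conj (p : ℕ) : ℕ → steenrodAlgebra p
  | 0 => 1
  | r + 1 => -∑ i : Fin (r + 1), P p (r + 1 - i) * conj p i
decreasing_by exact i.2

theorem P_zero (p : ℕ) : P p 0 = 1 := Subtype.ext (powerOp_zero p)

theorem sum_P_conj (p : ℕ) {r : ℕ} (hr : 0 < r) :
    ∑ j ∈ Finset.range (r + 1), P p (r - j) * conj p j = 0 := by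
  obtain ⟨r, rfl⟩ : ∃ s, r = s + 1 := ⟨r - 1, by omega⟩
  rw [Finset.sum_range_succ, Nat.sub_self, P_zero, one_mul, conj, ← Finset.sum_range
    (fun i => P p (r + 1 - i) * conj p i)]
  exact add_neg_cancel (G := steenrodAlgebra p) _

theorem sum_assoc {M : Type*} [AddCommMonoid M] (r : ℕ) (F : ℕ → ℕ → ℕ → M) :
    ∑ x ∈ Finset.HasAntidiagonal.antidiagonal r,
      ∑ y ∈ Finset.HasAntidiagonal.antidiagonal x.1, F y.1 y.2 x.2 =
    ∑ x ∈ Finset.HasAntidiagonal.antidiagonal r,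
      ∑ y ∈ Finset.HasAntidiagonal.antidiagonal x.2, F x.1 y.1 y.2 := by
  rw [Finset.sum_sigma', Finset.sum_sigma']
  refine Finset.sum_nbij' (fun z => ⟨(z.2.1, z.2.2 + z.1.2), (z.2.2, z.1.2)⟩)
    (fun z => ⟨(z.1.1 + z.2.1, z.2.2), (z.1.1, z.2.1)⟩) ?_ ?_ ?_ ?_ ?_
  · rintro ⟨⟨a, b⟩, ⟨c, d⟩⟩ h
    simp only [Finset.mem_sigma, Finset.HasAntidiagonal.mem_antidiagonal] at h ⊢
    obtain ⟨rfl, rfl⟩ := h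
    simp [add_assoc]
  · rintro ⟨⟨a, b⟩, ⟨c, d⟩⟩ h
    simp only [Finset.mem_sigma, Finset.HasAntidiagonal.mem_antidiagonal] at h ⊢
    obtain ⟨rfl, rfl⟩ := h
    simp [add_assoc]
  · rintro ⟨⟨a, b⟩, ⟨c, d⟩⟩ h
    simp only [Finset.mem_sigma, Finset.HasAntidiagonal.mem_antidiagonal] at h
    obtain ⟨rfl, rfl⟩ := h
    rfl
  · rintro ⟨⟨a, b⟩, ⟨c, d⟩⟩ h
    simp only [Finset.mem_sigma, Finset.HasAntidiagonal.mem_antidiagonal] at h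
    obtain ⟨rfl, rfl⟩ := h
    rfl
  · rintro ⟨⟨a, b⟩, ⟨c, d⟩⟩ h
    rfl

theorem sum_P_conj_apply (p : ℕ) (r : ℕ) (g : Poly p) :
    ∑ y ∈ Finset.HasAntidiagonal.antidiagonal r, powerOp p y.1 ((conj p y.2).1 g) =
      if r = 0 then g else 0 := by
  rw [← Finset.Nat.sum_antidiagonal_swap]
  simp only [Prod.fst_swap, Prod.snd_swap]
  rw [Finset.Nat.sum_antidiagonal_eq_sum_range_succ
    (fun j i => powerOp p i ((conj p j).1 g))]
  split_ifs with hr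
  · subst hr
    simp [powerOp_zero, conj]
  · have := congrArg (fun T : steenrodAlgebra p => T.1 g) (sum_P_conj p (Nat.pos_of_ne_zero hr))
    simpa [P] using this

theorem isAdjoint_conj (hp : p.Prime) (r : ℕ) : IsAdjoint p (P p r) (conj p r) := by
  intro e he f g
  have h1 : ∑ x ∈ Finset.HasAntidiagonal.antidiagonal r,
      powerOp p x.1 (f * (conj p x.2).1 g) = powerOp p r f * g := by
    simp only [powerOp_mul]
    rw [sum_assoc r (fun a b c => powerOp p a f * powerOp p b ((conj p c).1 g))]
    simp only [← Finset.mul_sum, sum_P_conj_apply]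
    rw [Finset.sum_eq_single (r, 0)]
    · simp
    · rintro ⟨a, b⟩ h hne
      rw [if_neg, mul_zero]
      rintro rfl
      rw [Finset.HasAntidiagonal.mem_antidiagonal] at h
      exact hne (by simpa using h)
    · intro h
      exact absurd (by simp [Finset.HasAntidiagonal.mem_antidiagonal]) h
  change MvPolynomial.coeff e (powerOp p r f * g) = _
  rw [← h1, MvPolynomial.coeff_sum, Finset.sum_eq_single (0, r)]
  · rw [powerOp_zero]
    rfl
  · rintro ⟨a, b⟩ h hne
    refine coeff_powerOp_top hp he (Nat.pos_of_ne_zero ?_) _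
    rintro rfl
    rw [Finset.HasAntidiagonal.mem_antidiagonal] at h
    exact hne (by simpa using h)
  · intro h
    exact absurd (by simp [Finset.HasAntidiagonal.mem_antidiagonal]) h

theorem exists_isAdjoint (hp : p.Prime) (T : steenrodAlgebra p) :
    ∃ T' : steenrodAlgebra p, IsAdjoint p T T' := by
  obtain ⟨T, hT⟩ := T
  induction hT using Algebra.adjoin_induction with
  | mem x hx =>
    obtain ⟨r, rfl⟩ := hx
    exact ⟨conj p r, isAdjoint_conj hp r⟩
  | algebraMap c => exact ⟨algebraMap _ _ c, IsAdjoint.algebraMap c⟩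
  | add x y hx hy ihx ihy =>
    obtain ⟨x', hx'⟩ := ihx
    obtain ⟨y', hy'⟩ := ihy
    exact ⟨x' + y', hx'.add hy'⟩
  | mul x y hx hy ihx ihy =>
    obtain ⟨x', hx'⟩ := ihx
    obtain ⟨y', hy'⟩ := ihy
    exact ⟨y' * x', hx'.mul hy'⟩

/-- `χ` is the antipode (canonical anti-automorphism) of the Hopf algebra `𝒜_p`, whose coproduct
is `P^r ↦ ∑ P^i ⊗ P^{r-i}`: an anti-automorphism with `∑_{i + j = r} P^i χ(P^j) = 0` for `r > 0`. -/
def IsAntipode (p : ℕ) (χ : steenrodAlgebra p ≃ₐ[ZMod p] (steenrodAlgebra p)ᵐᵒᵖ) : Prop :=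
  ∀ r, 0 < r → ∑ j ∈ Finset.range (r + 1), P p (r - j) * (χ (P p j)).unop = 0

theorem IsAntipode.apply_P {χ : steenrodAlgebra p ≃ₐ[ZMod p] (steenrodAlgebra p)ᵐᵒᵖ}
    (h : IsAntipode p χ) (r : ℕ) : (χ (P p r)).unop = conj p r := by
  induction r using Nat.strong_induction_on with
  | _ r ih =>
    rcases Nat.eq_zero_or_pos r with rfl | hr
    · simp [P_zero, conj]
    · have h1 := h r hr
      have h2 := sum_P_conj p hr
      rw [Finset.sum_range_succ, Nat.sub_self, P_zero, one_mul] at h1 h2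
      rw [Finset.sum_congr rfl fun j hj => by rw [ih j (Finset.mem_range.1 hj)]] at h1
      exact add_left_cancel (h1.trans h2.symm)

theorem existsUnique_isAntipode (hp : p.Prime) : ∃! χ, IsAntipode p χ := by
  choose c hc using exists_isAdjoint (p := p) hp
  have key : ∀ {T T' : steenrodAlgebra p}, IsAdjoint p T T' → c T = T' := fun h =>
    Subtype.ext ((hc _).eq hp h)
  refine ⟨{ toFun := fun T => MulOpposite.op (c T)
            invFun := fun T => c T.unop
            left_inv := fun T => key (hc T).symm
            right_inv := fun T => congrArg MulOpposite.op (key (hc T.unop).symm)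
            map_mul' := fun S T => congrArg MulOpposite.op (key ((hc S).mul (hc T)))
            map_add' := fun S T => congrArg MulOpposite.op (key ((hc S).add (hc T)))
            commutes' := fun a => congrArg MulOpposite.op (key (IsAdjoint.algebraMap a)) },
    ?_, ?_⟩
  · intro r hr
    rw [← sum_P_conj p hr]
    exact Finset.sum_congr rfl fun j _ => congrArg _ (key (isAdjoint_conj hp j))
  · intro χ hχ
    apply AlgEquiv.coe_toAlgHom_injective
    apply AlgHom.adjoin_ext
    rintro _ ⟨r, rfl⟩
    apply MulOpposite.unop_injective
    exact (hχ.apply_P r).trans (key (isAdjoint_conj hp r)).symm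


end Antipode

/-- The power series `x_j + ∑_{i ≥ 1} x_j ^ (p ^ i) ξ_i` in variables `ξ_1, ξ_2, …` over
`𝔽_p[x_0, x_1, …]`. The variable with index `i : ℕ` stands for `ξ_{i+1}`. -/
noncomputable def coactionVar (p j : ℕ) : MvPowerSeries ℕ (Poly p) := fun m =>
  if m = 0 then MvPolynomial.X j
  else ∑ i ∈ m.support, if m = Finsupp.single i 1 then MvPolynomial.X j ^ p ^ (i + 1) else 0

/-- Milnor's coaction `λ` of the dual `𝔽_p[ξ_1, ξ_2, …]` of `𝒜_p` on polynomials: the algebra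
homomorphism with `x_j ↦ x_j + ∑_{i ≥ 1} x_j ^ (p ^ i) ξ_i`. An operation `θ` acts by applying `θ`,
as a functional on `𝔽_p[ξ_1, ξ_2, …]`, to the coefficients of `λ(f)`. -/
noncomputable def coaction (p : ℕ) : Poly p →ₐ[ZMod p] MvPowerSeries ℕ (Poly p) :=
  MvPolynomial.aeval (coactionVar p)

/-- The operator of the Milnor basis element dual to the monomial `ξ^R`: it sends `f` to the
coefficient of `ξ^R` in `λ(f)`. -/
noncomputable def milnorOp (p : ℕ) (R : ℕ →₀ ℕ) : Module.End (ZMod p) (Poly p) :=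
  (MvPowerSeries.coeff R).restrictScalars (ZMod p) ∘ₗ (coaction p).toLinearMap

theorem milnorOp_apply (p : ℕ) (R : ℕ →₀ ℕ) (f : Poly p) :
    milnorOp p R f = MvPowerSeries.coeff R (coaction p f) := rfl

/-- The coaction with `ξ_i = 0` for `i > n`. -/
noncomputable def coactionTrunc (p n : ℕ) : Poly p →ₐ[ZMod p] MvPolynomial ℕ (Poly p) :=
  MvPolynomial.aeval fun j => MvPolynomial.C (MvPolynomial.X j) + ∑ i ∈ Finset.range n,
    MvPolynomial.C (MvPolynomial.X j ^ p ^ (i + 1)) * MvPolynomial.X i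

theorem coeff_coactionTrunc (p n : ℕ) (f : Poly p) (R : ℕ →₀ ℕ) (hR : R.support ⊆ Finset.range n) :
    MvPolynomial.coeff R (coactionTrunc p n f) = milnorOp p R f := by
  rw [milnorOp_apply]
  induction f using MvPolynomial.induction_on generalizing R with
  | C a =>
    classical
    rw [← MvPolynomial.algebraMap_eq, AlgHom.commutes, AlgHom.commutes,
      IsScalarTower.algebraMap_apply (ZMod p) (Poly p) (MvPolynomial ℕ (Poly p)),
      MvPolynomial.algebraMap_eq, MvPolynomial.coeff_C, MvPowerSeries.algebraMap_apply,
      MvPowerSeries.coeff_C]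
    simp only [eq_comm]
  | add f g hf hg => simp only [map_add, MvPolynomial.coeff_add, hf R hR, hg R hR]
  | mul_X f j hf =>
    classical
    rw [map_mul, map_mul, MvPolynomial.coeff_mul, MvPowerSeries.coeff_mul]
    refine Finset.sum_congr rfl fun x hx => ?_
    rw [Finset.HasAntidiagonal.mem_antidiagonal] at hx
    have h1 : x.1.support ⊆ Finset.range n :=
      (Finsupp.support_mono (hx ▸ le_self_add)).trans hR
    have h2 : x.2.support ⊆ Finset.range n :=
      (Finsupp.support_mono (hx ▸ le_add_self)).trans hR
    rw [hf _ h1]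
    congr 1
    generalize x.2 = m at h2
    rw [coactionTrunc, coaction, MvPolynomial.aeval_X, MvPolynomial.aeval_X]
    change _ = if m = 0 then MvPolynomial.X j
      else ∑ i ∈ m.support, if m = Finsupp.single i 1 then MvPolynomial.X j ^ p ^ (i + 1) else 0
    rw [MvPolynomial.coeff_add, MvPolynomial.coeff_C, MvPolynomial.coeff_sum]
    simp only [MvPolynomial.coeff_C_mul, MvPolynomial.coeff_X, mul_ite, mul_one, mul_zero]
    by_cases hm : m = 0
    · subst hm
      simp
    · rw [if_neg (Ne.symm hm), if_neg hm, zero_add, ← Finset.sum_subset h2]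
      · exact Finset.sum_congr rfl fun i _ => by simp only [eq_comm]
      · intro i _ hi
        rw [if_neg]
        rintro rfl
        simp at hi

/-- `(b_1, b_2, …) ↦ (b_2, b_3, …)`. -/
noncomputable def shift : (ℕ →₀ ℕ) →+ (ℕ →₀ ℕ) :=
  Finsupp.comapDomain.addMonoidHom Nat.succ_injective

theorem shift_apply (b : ℕ →₀ ℕ) (i : ℕ) : shift b i = b (i + 1) := rfl

theorem shift_single_zero : shift (Finsupp.single 0 1) = 0 := by
  ext k
  simp [shift_apply]

theorem shift_single_succ (i : ℕ) : shift (Finsupp.single (i + 1) 1) = Finsupp.single i 1 := by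
  ext k
  simp [shift_apply, Finsupp.single_apply]

/-- Auxiliary: `ξ_{i+1} + ξ_i T^(p^i)` (with `ξ_0 = 1`), where the first summand is dropped if
`n ≤ i`. -/
noncomputable def theta (p n i : ℕ) : Polynomial (MvPolynomial ℕ (ZMod p)) :=
  Polynomial.C (if i < n then MvPolynomial.X i else 0) +
    Polynomial.C (MvPolynomial.monomial (shift (Finsupp.single i 1)) 1) * Polynomial.X ^ p ^ i

/-- Auxiliary: the product of the powers of `theta` with exponents `Q`. -/
noncomputable def thetaPow (p n : ℕ) (Q : ℕ →₀ ℕ) : Polynomial (MvPolynomial ℕ (ZMod p)) :=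
  Q.prod fun i q => theta p n i ^ q

theorem thetaPow_add (p n : ℕ) (Q Q' : ℕ →₀ ℕ) :
    thetaPow p n (Q + Q') = thetaPow p n Q * thetaPow p n Q' :=
  Finsupp.prod_add_index' (fun _ => pow_zero _) (fun _ _ _ => pow_add _ _ _)

theorem thetaPow_single_one (p n i : ℕ) : thetaPow p n (Finsupp.single i 1) = theta p n i := by
  rw [thetaPow, Finsupp.prod_single_index (h := fun i q => theta p n i ^ q) (pow_zero _), pow_one]

theorem finsupp_induction {C : (ℕ →₀ ℕ) → Prop} (Q : ℕ →₀ ℕ) (zero : C 0)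
    (single : ∀ i, C (Finsupp.single i 1)) (add : ∀ Q Q', C Q → C Q' → C (Q + Q')) : C Q := by
  induction Q using Finsupp.induction_linear with
  | zero => exact zero
  | add f g hf hg => exact add f g hf hg
  | single i q =>
    induction q with
    | zero => simpa using zero
    | succ q ih => rw [Finsupp.single_add]; exact add _ _ ih (single i)

theorem coeff_thetaPow_ne_zero (p n : ℕ) (Q : ℕ →₀ ℕ) : ∀ (r : ℕ) (S : ℕ →₀ ℕ),
    MvPolynomial.coeff S ((thetaPow p n Q).coeff r) ≠ 0 → ∃ a b : ℕ →₀ ℕ,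
      Q = a + b ∧ S = a + shift b ∧ r = Finsupp.weight (fun i => p ^ i) b := by
  classical
  induction Q using finsupp_induction with
  | zero =>
    intro r S h
    simp only [thetaPow, Finsupp.prod_zero_index, Polynomial.coeff_one] at h
    split_ifs at h with hr
    · rw [MvPolynomial.coeff_one] at h
      split_ifs at h with hS
      · exact ⟨0, 0, by simp, by simp [← hS], by simp [hr]⟩
      · exact absurd rfl h
    · simp at h
  | single i =>
    intro r S h
    rw [thetaPow_single_one, theta, Polynomial.coeff_add, Polynomial.coeff_C,
      Polynomial.coeff_C_mul_X_pow, MvPolynomial.coeff_add] at h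
    by_cases h1 : r = 0 ∧ S = Finsupp.single i 1
    · exact ⟨Finsupp.single i 1, 0, by simp, by simp [h1.2], by simp [h1.1]⟩
    · refine ⟨0, Finsupp.single i 1, by simp, ?_⟩
      have h2 : MvPolynomial.coeff S (if r = 0 then
          (if i < n then (MvPolynomial.X i : MvPolynomial ℕ (ZMod p)) else 0) else 0) = 0 := by
        split_ifs with hr hi
        · rw [MvPolynomial.coeff_X, if_neg fun hS => h1 ⟨hr, hS.symm⟩]
        · simp
        · simp
      rw [h2, zero_add] at h
      split_ifs at h with hr
      · rw [MvPolynomial.coeff_monomial] at h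
        split_ifs at h with hS
        · exact ⟨by simp [hS], by simp [hr, Finsupp.weight_single]⟩
        · exact absurd rfl h
      · simp at h
  | add Q Q' ih ih' =>
    intro r S h
    rw [thetaPow_add, Polynomial.coeff_mul, MvPolynomial.coeff_sum] at h
    obtain ⟨⟨i, k⟩, hik, h⟩ := Finset.exists_ne_zero_of_sum_ne_zero h
    rw [MvPolynomial.coeff_mul] at h
    obtain ⟨⟨e1, e2⟩, he, h⟩ := Finset.exists_ne_zero_of_sum_ne_zero h
    rw [Finset.HasAntidiagonal.mem_antidiagonal] at hik he
    obtain ⟨h1, h2⟩ := ne_zero_and_ne_zero_of_mul h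
    obtain ⟨a, b, rfl, hS, hr⟩ := ih _ _ h1
    obtain ⟨a', b', rfl, hS', hr'⟩ := ih' _ _ h2
    refine ⟨a + a', b + b', add_add_add_comm _ _ _ _, ?_, ?_⟩
    · rw [← he, map_add]
      simp only at hS hS'
      rw [hS, hS']
      exact add_add_add_comm _ _ _ _
    · rw [← hik, map_add, ← hr, ← hr']

theorem coeff_thetaPow_self {p : ℕ} (hp : 0 < p) (n : ℕ) (Q : ℕ →₀ ℕ) :
    (thetaPow p n Q).natDegree ≤ Finsupp.weight (fun i => p ^ i) Q ∧
    (thetaPow p n Q).coeff (Finsupp.weight (fun i => p ^ i) Q) =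
      MvPolynomial.monomial (shift Q) 1 := by
  induction Q using finsupp_induction with
  | zero => simp [thetaPow]
  | single i =>
    have hpi : p ^ i ≠ 0 := (Nat.pow_pos hp).ne'
    rw [thetaPow_single_one, theta, Finsupp.weight_single, one_smul]
    constructor
    · refine (Polynomial.natDegree_add_le _ _).trans (max_le ?_ ?_)
      · simp
      · exact Polynomial.natDegree_C_mul_X_pow_le _ _
    · rw [Polynomial.coeff_add, Polynomial.coeff_C, if_neg hpi, zero_add,
        Polynomial.coeff_C_mul_X_pow, if_pos rfl]
  | add Q Q' ih ih' =>
    rw [thetaPow_add, map_add, map_add]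
    refine ⟨Polynomial.natDegree_mul_le_of_le ih.1 ih'.1, ?_⟩
    rw [Polynomial.coeff_mul_add_eq_of_natDegree_le ih.1 ih'.1, ih.2, ih'.2,
      MvPolynomial.monomial_mul, one_mul]

/-- Auxiliary: the total Steenrod power applied to the coefficients. -/
noncomputable def phi (p : ℕ) : MvPolynomial ℕ (Poly p) →+* Polynomial (MvPolynomial ℕ (Poly p)) :=
  MvPolynomial.eval₂Hom ((Polynomial.mapRingHom MvPolynomial.C).comp (totalPower p).toRingHom)
    fun i => Polynomial.C (MvPolynomial.X i)

/-- Auxiliary: the substitution `ξ_{i+1} ↦ theta p n i`. -/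
noncomputable def psi (p n : ℕ) :
    MvPolynomial ℕ (Poly p) →+* Polynomial (MvPolynomial ℕ (Poly p)) :=
  MvPolynomial.eval₂Hom (Polynomial.C.comp MvPolynomial.C)
    fun i => Polynomial.map (MvPolynomial.map MvPolynomial.C) (theta p n i)

theorem coeff_phi (p r : ℕ) (S : ℕ →₀ ℕ) (F : MvPolynomial ℕ (Poly p)) :
    MvPolynomial.coeff S ((phi p F).coeff r) = powerOp p r (MvPolynomial.coeff S F) := by
  classical
  induction F using MvPolynomial.induction_on' with
  | add F G hF hG =>
    rw [map_add, Polynomial.coeff_add, MvPolynomial.coeff_add, hF, hG, MvPolynomial.coeff_add,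
      map_add]
  | monomial m a =>
    have h1 : phi p (MvPolynomial.monomial m a) =
        Polynomial.map MvPolynomial.C (totalPower p a) *
          Polynomial.C (MvPolynomial.monomial m 1) := by
      rw [phi, MvPolynomial.coe_eval₂Hom, MvPolynomial.eval₂_monomial,
        MvPolynomial.monomial_eq (s := m), map_mul, map_one, map_one, one_mul, map_finsuppProd]
      simp only [map_pow]
      rfl
    rw [h1, Polynomial.coeff_mul_C, Polynomial.coeff_map, MvPolynomial.C_mul_monomial, mul_one,
      MvPolynomial.coeff_monomial, MvPolynomial.coeff_monomial, ← powerOp_apply]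
    split_ifs
    · rfl
    · simp

theorem psi_monomial (p n : ℕ) (Q : ℕ →₀ ℕ) (a : Poly p) :
    psi p n (MvPolynomial.monomial Q a) = Polynomial.C (MvPolynomial.C a) *
      Polynomial.map (MvPolynomial.map MvPolynomial.C) (thetaPow p n Q) := by
  rw [psi, MvPolynomial.coe_eval₂Hom, MvPolynomial.eval₂_monomial, thetaPow,
    ← Polynomial.coe_mapRingHom, map_finsuppProd]
  simp only [map_pow]
  rfl

theorem coeff_psi (p n r : ℕ) (S : ℕ →₀ ℕ) (F : MvPolynomial ℕ (Poly p)) :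
    MvPolynomial.coeff S ((psi p n F).coeff r) =
      ∑ Q ∈ F.support, MvPolynomial.coeff S ((thetaPow p n Q).coeff r) • F.coeff Q := by
  conv_lhs => rw [F.as_sum]
  rw [map_sum, Polynomial.finsetSum_coeff, MvPolynomial.coeff_sum]
  refine Finset.sum_congr rfl fun Q _ => ?_
  rw [psi_monomial, Polynomial.coeff_C_mul, MvPolynomial.coeff_C_mul, Polynomial.coeff_map,
    MvPolynomial.coeff_map, mul_comm, MvPolynomial.smul_eq_C_mul]

theorem phi_coactionTrunc {p : ℕ} (hp : p.Prime) (n : ℕ) (f : Poly p) :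
    phi p (coactionTrunc p n f) = psi p n (coactionTrunc p (n + 1) f) := by
  have := Fact.mk hp
  have h0 : ∀ a, phi p (MvPolynomial.C a) =
      Polynomial.map MvPolynomial.C (totalPower p a) := fun a => MvPolynomial.eval₂Hom_C _ _ a
  have h1 : ∀ a, psi p n (MvPolynomial.C a) = Polynomial.C (MvPolynomial.C a) :=
    fun a => MvPolynomial.eval₂Hom_C _ _ a
  have h2 : ∀ i, phi p (MvPolynomial.X i) = Polynomial.C (MvPolynomial.X i) :=
    fun a => MvPolynomial.eval₂Hom_X' _ _ a
  have h3 : ∀ i, psi p n (MvPolynomial.X i) =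
      Polynomial.map (MvPolynomial.map MvPolynomial.C) (theta p n i) :=
    fun a => MvPolynomial.eval₂Hom_X' _ _ a
  have h4 : ∀ j, totalPower p (MvPolynomial.X j) = Polynomial.C (MvPolynomial.X j) +
      Polynomial.C (MvPolynomial.X j ^ p) * Polynomial.X := fun j => MvPolynomial.aeval_X _ j
  have key : (phi p).comp (coactionTrunc p n).toRingHom =
      (psi p n).comp (coactionTrunc p (n + 1)).toRingHom := by
    apply MvPolynomial.ringHom_ext
    · intro a
      simp only [RingHom.comp_apply, AlgHom.toRingHom_eq_coe, RingHom.coe_coe]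
      rw [← MvPolynomial.algebraMap_eq, AlgHom.commutes, AlgHom.commutes,
        IsScalarTower.algebraMap_apply (ZMod p) (Poly p) (MvPolynomial ℕ (Poly p)),
        MvPolynomial.algebraMap_eq, h0, h1, AlgHom.commutes,
        IsScalarTower.algebraMap_apply (ZMod p) (Poly p) (Polynomial (Poly p)),
        Polynomial.algebraMap_eq, Polynomial.map_C]
    · intro j
      simp only [RingHom.comp_apply, AlgHom.toRingHom_eq_coe, RingHom.coe_coe]
      rw [coactionTrunc, coactionTrunc, MvPolynomial.aeval_X, MvPolynomial.aeval_X]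
      have h5 : ∀ i, (Polynomial.map (MvPolynomial.map MvPolynomial.C) (theta p n i) :
          Polynomial (MvPolynomial ℕ (Poly p))) =
          (if i < n then Polynomial.C (MvPolynomial.X i) else 0) + Polynomial.C
            (MvPolynomial.monomial (shift (Finsupp.single i 1)) 1) * Polynomial.X ^ p ^ i := by
        intro i
        rw [theta]
        split_ifs <;> simp
      simp only [map_add, map_sum, map_mul, h0, h1, h2, h3, map_pow, h4, h5, Polynomial.map_add,
        Polynomial.map_mul, Polynomial.map_pow, Polynomial.map_C, Polynomial.map_X, mul_add,
        Finset.sum_add_distrib]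
      rw [Finset.sum_range_succ, Finset.sum_range_succ' (n := n), shift_single_zero]
      simp only [lt_irrefl, if_false, mul_zero, add_zero, shift_single_succ]
      rw [Finset.sum_congr rfl (g := fun i =>
        (Polynomial.C (MvPolynomial.C (MvPolynomial.X j)) : Polynomial (MvPolynomial ℕ (Poly p)))
          ^ p ^ (i + 1) * Polynomial.C (MvPolynomial.X i) +
        (Polynomial.C (MvPolynomial.C (MvPolynomial.X j)) : Polynomial (MvPolynomial ℕ (Poly p)))
          ^ p ^ (i + 1 + 1) * (Polynomial.C (MvPolynomial.X i) * Polynomial.X ^ p ^ (i + 1)))]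
      · rw [Finset.sum_add_distrib, Finset.sum_congr rfl (g := fun i =>
          (Polynomial.C (MvPolynomial.C (MvPolynomial.X j)) : Polynomial (MvPolynomial ℕ (Poly p)))
          ^ p ^ (i + 1) * (if i < n then Polynomial.C (MvPolynomial.X i) else 0))
          fun i hi => by rw [if_pos (Finset.mem_range.1 hi)]]
        simp only [zero_add, pow_one, pow_zero, MvPolynomial.monomial_zero', map_one, one_mul]
        simp only [MvPolynomial.X]
        ring
      · intro i _
        rw [add_pow_char_pow, mul_pow, ← pow_mul, ← pow_succ']
        ring
  exact RingHom.congr_fun key f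

theorem weight_eq (p : ℕ) (b : ℕ →₀ ℕ) : Finsupp.weight (fun i => p ^ i) b =
    b 0 + p * Finsupp.weight (fun i => p ^ i) (shift b) := by
  induction b using finsupp_induction with
  | zero => simp
  | add Q Q' h h' => rw [map_add, h, h', map_add, map_add, Finsupp.add_apply]; ring
  | single i =>
    cases i with
    | zero => simp [shift_single_zero, Finsupp.weight_single]
    | succ i => simp [shift_single_succ, Finsupp.weight_single, pow_succ']

theorem powerOp_mul_milnorOp {p : ℕ} (hp : p.Prime) (r : ℕ) (S : ℕ →₀ ℕ) :
    ∃ (s : Finset (ℕ →₀ ℕ)) (N : (ℕ →₀ ℕ) → ZMod p),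
      powerOp p r * milnorOp p S = ∑ Q ∈ s, N Q • milnorOp p Q ∧
      (∀ Q ∈ s, N Q ≠ 0 → ∃ a b : ℕ →₀ ℕ, Q = a + b ∧ S = a + shift b ∧
        r = Finsupp.weight (fun i => p ^ i) b) ∧
      ∀ Q, S = shift Q → r = Finsupp.weight (fun i => p ^ i) Q → Q ∈ s ∧ N Q = 1 := by
  classical
  obtain ⟨n, hn⟩ : ∃ n, S.support ⊆ Finset.range n :=
    ⟨S.support.sup id + 1, fun i hi => Finset.mem_range.2
      (Nat.lt_succ_of_le (Finset.le_sup (f := id) hi))⟩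
  let M : ℕ →₀ ℕ := S + (Finsupp.single 0 r + S.mapDomain Nat.succ)
  have hM : ∀ a b : ℕ →₀ ℕ, S = a + shift b → r = Finsupp.weight (fun i => p ^ i) b →
      a + b ≤ M := by
    intro a b hS hr
    refine add_le_add (hS ▸ le_self_add) fun i => ?_
    rw [Finsupp.add_apply]
    cases i with
    | zero =>
      have := weight_eq p b
      simp; omega
    | succ i =>
      have h1 := Finsupp.mapDomain_apply Nat.succ_injective S i
      have h2 : S i = a i + b (i + 1) := by rw [hS]; rfl
      simp only [Nat.succ_eq_add_one] at h1
      rw [h1]; omega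
  have hMs : ∀ Q ≤ M, Q.support ⊆ Finset.range (n + 1) := by
    intro Q hQ
    refine (Finsupp.support_mono hQ).trans fun i hi => ?_
    rw [Finset.mem_range]
    by_contra hlt
    obtain ⟨i, rfl⟩ : ∃ k, i = k + 1 := ⟨i - 1, by omega⟩
    have h1 := Finsupp.mapDomain_apply Nat.succ_injective S i
    simp only [Nat.succ_eq_add_one] at h1
    have hS : ∀ k, n ≤ k → S k = 0 := fun k hk => by
      by_contra hne
      have := Finset.mem_range.1 (hn (Finsupp.mem_support_iff.2 hne))
      omega
    rw [Finsupp.mem_support_iff, Finsupp.add_apply, Finsupp.add_apply, h1, hS _ (by omega),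
      hS _ (by omega)] at hi
    simp at hi
  refine ⟨Finset.Icc 0 M, fun Q => MvPolynomial.coeff S ((thetaPow p n Q).coeff r), ?_,
    fun Q _ hQ => coeff_thetaPow_ne_zero p n Q r S hQ, ?_⟩
  · refine LinearMap.ext fun f => ?_
    rw [Module.End.mul_apply, ← coeff_coactionTrunc p n f S hn, ← coeff_phi, phi_coactionTrunc hp,
      coeff_psi, LinearMap.sum_apply]
    simp only [LinearMap.smul_apply]
    refine Finset.sum_congr_of_eq_on_inter ?_ ?_ ?_
    · intro Q _ hQ
      by_contra hne
      obtain ⟨a, b, rfl, hS, hr⟩ := coeff_thetaPow_ne_zero p n Q r S (left_ne_zero_of_smul hne)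
      exact hQ (Finset.mem_Icc.2 ⟨zero_le, hM a b hS hr⟩)
    · intro Q hQ hQ'
      rw [← coeff_coactionTrunc p (n + 1) f Q (hMs Q (Finset.mem_Icc.1 hQ).2),
        MvPolynomial.notMem_support_iff.1 hQ', smul_zero]
    · intro Q _ hQ
      rw [coeff_coactionTrunc p (n + 1) f Q (hMs Q (Finset.mem_Icc.1 hQ).2)]
  · intro Q hS hr
    refine ⟨Finset.mem_Icc.2 ⟨zero_le, ?_⟩, ?_⟩
    · simpa using hM 0 Q (by simpa using hS) hr
    · change MvPolynomial.coeff S ((thetaPow p n Q).coeff r) = 1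
      rw [hr, (coeff_thetaPow_self hp.pos n Q).2, hS, MvPolynomial.coeff_monomial, if_pos rfl]

theorem milnorOp_zero (p : ℕ) : milnorOp p 0 = 1 := by
  refine LinearMap.ext fun f => ?_
  rw [← coeff_coactionTrunc p 0 f 0 (by simp)]
  have : coactionTrunc p 0 = IsScalarTower.toAlgHom (ZMod p) (Poly p) _ := by
    apply MvPolynomial.algHom_ext
    intro j
    simp [coactionTrunc]
  rw [this]
  simp

/-- Auxiliary: `∑ r_i (p ^ i - 1) / (p - 1)`. -/
noncomputable def deg (p : ℕ) : (ℕ →₀ ℕ) →+ ℕ :=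
  Finsupp.weight (fun i => ∑ k ∈ Finset.range (i + 1), p ^ k)

theorem deg_eq (p : ℕ) (b : ℕ →₀ ℕ) :
    deg p b = Finsupp.weight (fun i => p ^ i) b + deg p (shift b) := by
  induction b using finsupp_induction with
  | zero => simp
  | add Q Q' h h' => rw [map_add, h, h', map_add, map_add, map_add]; ring
  | single i =>
    cases i with
    | zero => simp [shift_single_zero, Finsupp.weight_single, deg]
    | succ i =>
      rw [shift_single_succ, deg, Finsupp.weight_single, Finsupp.weight_single,
        Finsupp.weight_single, Finset.sum_range_succ, one_smul, one_smul, one_smul, add_comm]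

theorem degree_eq (b : ℕ →₀ ℕ) : b.degree = b 0 + (shift b).degree := by
  induction b using finsupp_induction with
  | zero => simp
  | add Q Q' h h' => rw [map_add, h, h', map_add, map_add, Finsupp.add_apply]; ring
  | single i =>
    cases i with
    | zero => simp [shift_single_zero]
    | succ i => simp [shift_single_succ]

theorem degree_le_deg {p : ℕ} (b : ℕ →₀ ℕ) : b.degree ≤ deg p b := by
  induction b using finsupp_induction with
  | zero => simp
  | add Q Q' h h' => rw [map_add, map_add]; exact add_le_add h h'
  | single i =>
    rw [Finsupp.degree_single, deg, Finsupp.weight_single, one_smul, Finset.sum_range_succ', pow_zero]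
    omega

theorem degree_le_weight {p : ℕ} (hp : 0 < p) (b : ℕ →₀ ℕ) :
    b.degree ≤ Finsupp.weight (fun i => p ^ i) b := by
  induction b using finsupp_induction with
  | zero => simp
  | add Q Q' h h' => rw [map_add, map_add]; exact add_le_add h h'
  | single i =>
    rw [Finsupp.degree_single, Finsupp.weight_single, one_smul]
    exact Nat.pow_pos hp

theorem milnorOp_mem {p : ℕ} (hp : p.Prime) (R : ℕ →₀ ℕ) : milnorOp p R ∈ steenrodAlgebra p := by
  by_cases hR : R = 0
  · rw [hR, milnorOp_zero]
    exact one_mem _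
  have hpos : 0 < Finsupp.weight (fun i => p ^ i) R :=
    lt_of_lt_of_le (Nat.pos_of_ne_zero fun h => hR ((Finsupp.degree_eq_zero_iff R).1 h))
      (degree_le_weight hp.pos R)
  have hdeg := deg_eq p R
  obtain ⟨s, N, hs, hN, hN'⟩ :=
    powerOp_mul_milnorOp hp (Finsupp.weight (fun i => p ^ i) R) (shift R)
  obtain ⟨hRs, hNR⟩ := hN' R rfl rfl
  have hS : milnorOp p (shift R) ∈ steenrodAlgebra p := milnorOp_mem hp (shift R)
  have hmem := mul_mem (P p (Finsupp.weight (fun i => p ^ i) R)).2 hS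
  change powerOp p _ * _ ∈ _ at hmem
  rw [hs, ← Finset.add_sum_erase s _ hRs, hNR, one_smul] at hmem
  refine (add_mem_cancel_right (H := steenrodAlgebra p) (sum_mem fun Q hQ => ?_)).1 hmem
  by_cases hQN : N Q = 0
  · rw [hQN, zero_smul]
    exact zero_mem _
  obtain ⟨hQR, hQs⟩ := Finset.mem_erase.1 hQ
  obtain ⟨a, b, hab, hSab, hr⟩ := hN Q hQs hQN
  have hd : deg p Q = deg p R := by
    rw [hab, map_add, deg_eq p b, hdeg, hr, hSab, map_add]; ring
  have h1 := weight_eq p R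
  have h2 := weight_eq p b
  have h3 := degree_eq R
  have h4 := degree_eq b
  rw [hSab, map_add] at h1 h3
  have h5 : Q.degree = a.degree + b.degree := by rw [hab, map_add]
  have h6 : 0 < Finsupp.weight (fun i => p ^ i) a := by
    refine lt_of_lt_of_le (Nat.pos_of_ne_zero fun h => ?_) (degree_le_weight hp.pos a)
    have ha := (Finsupp.degree_eq_zero_iff a).1 h
    subst ha
    rw [zero_add] at hab hSab
    refine hQR (Finsupp.ext fun i => ?_)
    rw [hab]
    cases i with
    | zero => simp only [map_zero, zero_add] at h1; omega
    | succ i => exact (DFunLike.congr_fun hSab i).symm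
  have h7 : Q.degree ≤ deg p Q := degree_le_deg Q
  have hlt : R.degree < Q.degree := by
    rw [mul_add] at h1
    have := Nat.mul_pos hp.pos h6
    omega
  exact Subalgebra.smul_mem _ (milnorOp_mem hp Q) _
termination_by (deg p R, deg p R - R.degree)
decreasing_by
  · exact Prod.Lex.left _ _ (by omega)
  · rw [hd]
    exact Prod.Lex.right _ (by omega)

/-- The Milnor basis element `P(R) = P(r_1, r_2, …)` of `𝒜_p`, dual to `ξ^R = ξ_1^{r_1} ξ_2^{r_2} ⋯`.
The entry `r_{i+1}` is `R i`. -/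
noncomputable def milnor (p : ℕ) [Fact p.Prime] (R : ℕ →₀ ℕ) : steenrodAlgebra p :=
  ⟨milnorOp p R, milnorOp_mem Fact.out R⟩

/-- The canonical anti-automorphism `χ` of `𝒜_p`, as an isomorphism to the opposite algebra. -/
noncomputable def chi (p : ℕ) [Fact p.Prime] :
    steenrodAlgebra p ≃ₐ[ZMod p] (steenrodAlgebra p)ᵐᵒᵖ :=
  (existsUnique_isAntipode Fact.out).choose

theorem chi_isAntipode (p : ℕ) [Fact p.Prime] : IsAntipode p (chi p) :=
  (existsUnique_isAntipode Fact.out).choose_spec.1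

/-- `P̂^r = (-1)^r χ(P^r)`. -/
noncomputable def hatP (p : ℕ) [Fact p.Prime] (r : ℕ) : steenrodAlgebra p :=
  (-1) ^ r * (chi p (P p r)).unop

/-- `p_n = (p^n - 1) / (p - 1)`. -/
def pnum (p n : ℕ) : ℕ := (p ^ n - 1) / (p - 1)

/-- The sequence `(p - 1, …, p - 1, b)` of length `n ≥ 1`. -/
noncomputable def milnorIndex (p n b : ℕ) : ℕ →₀ ℕ :=
  ∑ i ∈ Finset.range (n - 1), Finsupp.single i (p - 1) + Finsupp.single (n - 1) b

/-- The list `(b+1)p^{n-1} - 1, …, (b+1)p - 1, b`. -/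
def exponents (p n b : ℕ) : List ℕ :=
  (List.range n).reverse.map fun k => (b + 1) * p ^ k - 1

/-- The monomial `P^{t_1} P^{t_2} ⋯ P^{t_m}`. -/
noncomputable def powerMonomial (p : ℕ) (t : List ℕ) : steenrodAlgebra p := (t.map (P p)).prod

/-- The monomial `P^{t_1} ⋯ P^{t_m}` is admissible: `t_i ≥ p t_{i+1}`, and all `t_i` are positive. -/
def IsAdmissible (p : ℕ) (t : List ℕ) : Prop :=
  t.IsChain (fun s t => p * t ≤ s) ∧ ∀ s ∈ t, 0 < s

end PthPowers

/-!
Setting `ξ_i = 1` in Milnor's product formula gives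

  `P^r · ∑_{deg S = e} P(S) = ∑_{deg Q = r + e} (w(Q) choose r) P(Q)`,

where `w(Q) = ∑ p^i Q i` (`powerOp_mul_milnorSum`): the coefficient of `P(Q)` is the coefficient of
`T^r` in `∏ (1 + T^(p^i))^(Q i) = (1 + T)^(w(Q))`. Since alternating sums of binomial coefficients
vanish, the signed sums `(-1)^j ∑_{deg S = j} P(S)` satisfy the recursion that characterizes
`χ(P^j)`. Hence `P̂^d` is the sum of all `P(Q)` of degree `d` (`coe_hatP`).

Let `Q₀ = (p - 1, …, p - 1, b)`, of length `n`. It has degree `(b + 1) p_n - n`, weight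
`w(Q₀) = (b + 1) p^(n-1) - 1` and sum of entries `|Q₀| = (n - 1)(p - 1) + b`. By the identity
`p w(Q) = (p - 1) deg Q + |Q|`, sequences of the same degree are compared by `|Q|` or, equivalently,
by `w(Q)`. As `Q₀` consists of the base `p` digits of `w(Q₀)`, it is the unique sequence of its
degree that minimizes both (`eq_milnorIndex_or_le_weight`), and every other one has
`w(Q) ≥ (b + 1) p^(n-1)` and `|Q| ≥ |Q₀| + p > n (p - 1) + b`.

* A polynomial of degree less than `|Q|` is annihilated by `P(Q)`. So only `P(Q₀)` contributes to
  `P̂^d g` when `g` has degree at most `n (p - 1) + b`.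
* For `r = (b + 1) p^(n-1)`, the binomial coefficient `(w(Q) choose r)` is `0` for `Q = Q₀`, since
  `w(Q₀) < r`, and `1` modulo `p` for all other `Q` of that degree, by Lucas' theorem. So `P^r P̂^(d - r)` is `P̂^d - P(Q₀)`.
* In the product of `P^(w(Q₀))` with the Milnor basis element of the shortened sequence, every term
  other than `P(Q₀)` has a binomial coefficient with a carry from a last digit `p - 1`, so it
  vanishes (`eq_zero_of_shift_milnorIndex_eq`). Induction on `n` gives the monomial of Steenrod
  powers.
-/

namespace PthPowers

/-! ### Products of a Steenrod power with Milnor basis elements -/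

theorem powerOp_milnorOp_apply {p : ℕ} (hp : p.Prime) (n r : ℕ) (S : ℕ →₀ ℕ)
    (hS : S.support ⊆ Finset.range n) (f : Poly p) :
    powerOp p r (milnorOp p S f) = ∑ Q ∈ (coactionTrunc p (n + 1) f).support,
      MvPolynomial.coeff S ((thetaPow p n Q).coeff r) • (coactionTrunc p (n + 1) f).coeff Q := by
  rw [← coeff_coactionTrunc p n f S hS, ← coeff_phi, phi_coactionTrunc hp, coeff_psi]

theorem exists_theta_pow_eq_sum (p n i q : ℕ) : ∃ u : ℕ → ZMod p, theta p n i ^ q =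
    ∑ k ∈ Finset.range (q + 1), Polynomial.C (MvPolynomial.monomial
      (Finsupp.single i (q - k) + shift (Finsupp.single i k)) ((q.choose k : ZMod p) * u k)) *
        Polynomial.X ^ (k * p ^ i) := by
  have hX : ∀ m, ∃ u : ZMod p, (if i < n then MvPolynomial.X i else 0 :
      MvPolynomial ℕ (ZMod p)) ^ m = MvPolynomial.monomial (Finsupp.single i m) u := by
    intro m
    split_ifs
    · exact ⟨1, MvPolynomial.X_pow_eq_monomial⟩
    · rcases m.eq_zero_or_pos with rfl | hm
      · exact ⟨1, by simp⟩
      · exact ⟨0, by rw [zero_pow hm.ne', map_zero]⟩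
  choose u hu using hX
  refine ⟨fun k => u (q - k), ?_⟩
  rw [theta, add_comm, add_pow]
  refine Finset.sum_congr rfl fun k _ => ?_
  have h1 : (MvPolynomial.monomial (shift (Finsupp.single i k)) 1 : MvPolynomial ℕ (ZMod p)) =
      MvPolynomial.monomial (shift (Finsupp.single i 1)) 1 ^ k := by
    rw [MvPolynomial.monomial_pow, one_pow, ← map_nsmul, Finsupp.smul_single_one]
  have h2 : MvPolynomial.monomial (Finsupp.single i (q - k) + shift (Finsupp.single i k))
      ((q.choose k : ZMod p) * u (q - k)) = (q.choose k : MvPolynomial ℕ (ZMod p)) *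
        (MvPolynomial.monomial (Finsupp.single i (q - k)) (u (q - k)) *
          MvPolynomial.monomial (shift (Finsupp.single i k)) 1) := by
    rw [MvPolynomial.monomial_mul, mul_one, ← map_natCast (MvPolynomial.C (σ := ℕ) (R := ZMod p)),
      MvPolynomial.C_mul_monomial]
  rw [h2, h1, ← hu, mul_comm k, pow_mul]
  simp only [map_mul, map_pow, map_natCast]
  ring

/-- The coefficient of `ξ^S T^r` in `∏ (ξ_{i+1} + ξ_i T^(p^i))^(Q i)` is non-zero only if it comes
from a splitting `Q = a + c` all of whose binomial coefficients are non-zero modulo `p`. -/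
theorem exists_of_coeff_thetaPow_ne_zero {p : ℕ} [Nontrivial (ZMod p)] (n : ℕ) (Q : ℕ →₀ ℕ) :
    ∀ (r : ℕ) (S : ℕ →₀ ℕ), MvPolynomial.coeff S ((thetaPow p n Q).coeff r) ≠ 0 →
      ∃ a c : ℕ →₀ ℕ, Q = a + c ∧ S = a + shift c ∧ r = Finsupp.weight (fun i => p ^ i) c ∧
        ∀ i, ((Q i).choose (c i) : ZMod p) ≠ 0 := by
  classical
  induction Q using Finsupp.induction with
  | zero =>
    intro r S h
    obtain ⟨a, c, h0, hS, hr⟩ := coeff_thetaPow_ne_zero p n 0 r S h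
    obtain ⟨rfl, rfl⟩ := add_eq_zero.1 h0.symm
    exact ⟨0, 0, by simp, hS, hr, by simp⟩
  | single_add i q Q hi hq ih =>
    intro r S h
    have hpow : thetaPow p n (Finsupp.single i q) = theta p n i ^ q :=
      Finsupp.prod_single_index (h := fun i q => theta p n i ^ q) (pow_zero _)
    obtain ⟨u, hu⟩ := exists_theta_pow_eq_sum p n i q
    rw [thetaPow_add, hpow, hu, Finset.sum_mul, Polynomial.finsetSum_coeff,
      MvPolynomial.coeff_sum] at h
    obtain ⟨k, hk, h⟩ := Finset.exists_ne_zero_of_sum_ne_zero h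
    have hkq : k ≤ q := Nat.lt_succ_iff.1 (Finset.mem_range.1 hk)
    rw [mul_assoc, Polynomial.coeff_C_mul, MvPolynomial.coeff_monomial_mul',
      Polynomial.coeff_X_pow_mul'] at h
    split_ifs at h with h1 h2
    · obtain ⟨a, c, hQ, hS, hr, hc⟩ := ih _ _ (right_ne_zero_of_mul h)
      have hci : Q i = 0 := Finsupp.notMem_support_iff.1 hi
      have hQi : a i + c i = 0 := by rw [← Finsupp.add_apply, ← hQ, hci]
      refine ⟨Finsupp.single i (q - k) + a, Finsupp.single i k + c, ?_, ?_, ?_, ?_⟩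
      · rw [add_add_add_comm, ← Finsupp.single_add, Nat.sub_add_cancel hkq, hQ]
      · rw [map_add, add_add_add_comm, ← hS, add_tsub_cancel_of_le h1]
      · rw [map_add, ← hr, Finsupp.weight_single, smul_eq_mul, Nat.add_sub_cancel' h2]
      · intro j
        rw [Finsupp.add_apply, Finsupp.add_apply]
        by_cases hj : j = i
        · subst hj
          rw [Finsupp.single_eq_same, Finsupp.single_eq_same, hci,
            Nat.eq_zero_of_add_eq_zero_left hQi]
          exact left_ne_zero_of_mul (left_ne_zero_of_mul h)
        · rw [Finsupp.single_eq_of_ne hj, Finsupp.single_eq_of_ne hj, zero_add, zero_add]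
          exact hc j
    · simp at h
    · simp at h

/-- If the only splitting `a + shift c = shift Q` with `c` of the weight of `Q` and with non-zero
binomial coefficients is `a = 0`, `c = Q`, then Milnor's product formula has a single term. -/
theorem powerOp_mul_milnorOp_shift {p : ℕ} (hp : p.Prime) (Q : ℕ →₀ ℕ)
    (hQ : ∀ a c : ℕ →₀ ℕ, shift Q = a + shift c →
      Finsupp.weight (fun i => p ^ i) Q = Finsupp.weight (fun i => p ^ i) c →
      (∀ i, ((a i + c i).choose (c i) : ZMod p) ≠ 0) → a = 0) :
    powerOp p (Finsupp.weight (fun i => p ^ i) Q) * milnorOp p (shift Q) = milnorOp p Q := by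
  have := Fact.mk hp
  refine LinearMap.ext fun f => ?_
  obtain ⟨n, hn⟩ : ∃ n, Q.support ⊆ Finset.range n :=
    ⟨Q.support.sup id + 1, fun i hi => Finset.mem_range.2
      (Nat.lt_succ_of_le (Finset.le_sup (f := id) hi))⟩
  have hn' : (shift Q).support ⊆ Finset.range n := fun i hi => by
    have h1 : Q (i + 1) ≠ 0 := by rwa [← shift_apply, ← Finsupp.mem_support_iff]
    have := Finset.mem_range.1 (hn (Finsupp.mem_support_iff.2 h1))
    exact Finset.mem_range.2 (by omega)
  rw [Module.End.mul_apply, powerOp_milnorOp_apply hp n _ _ hn', Finset.sum_eq_single Q]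
  · rw [(coeff_thetaPow_self hp.pos n Q).2, MvPolynomial.coeff_monomial, if_pos rfl, one_smul,
      coeff_coactionTrunc p (n + 1) f Q (hn.trans (Finset.range_mono (Nat.le_succ n)))]
  · intro R _ hR
    by_contra hne
    obtain ⟨a, c, rfl, hS, hr, hc⟩ := exists_of_coeff_thetaPow_ne_zero n R _ _
      (left_ne_zero_of_smul hne)
    obtain rfl := hQ a c hS hr hc
    rw [zero_add] at hS
    refine hR (Finsupp.ext fun i => ?_)
    cases i with
    | zero =>
      have h1 := weight_eq p Q
      have h2 := weight_eq p c
      rw [hS] at h1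
      rw [zero_add]
      omega
    | succ i => rw [zero_add, ← shift_apply, ← shift_apply, hS]
  · intro h
    rw [MvPolynomial.notMem_support_iff.1 h, smul_zero]

/-! ### The sum of the Milnor basis elements of a given degree -/

theorem apply_le_deg (p : ℕ) (Q : ℕ →₀ ℕ) (i : ℕ) : Q i ≤ deg p Q :=
  (Finsupp.le_degree i Q).trans (degree_le_deg Q)

theorem lt_deg_of_mem_support {p : ℕ} (hp : 0 < p) {Q : ℕ →₀ ℕ} {i : ℕ} (hi : i ∈ Q.support) :
    i < deg p Q := by
  have h1 : Finsupp.single i 1 ≤ Q :=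
    Finsupp.single_le_iff.2 (Nat.pos_of_ne_zero (Finsupp.mem_support_iff.1 hi))
  have h2 : deg p (Finsupp.single i 1) ≤ deg p Q := by
    rw [← add_tsub_cancel_of_le h1, map_add]; exact Nat.le_add_right _ _
  have h3 : ∑ k ∈ Finset.range (i + 1), 1 ≤ ∑ k ∈ Finset.range (i + 1), p ^ k :=
    Finset.sum_le_sum fun k _ => Nat.pow_pos hp
  rw [deg, Finsupp.weight_single, one_smul] at h2
  simp only [Finset.sum_const, Finset.card_range, smul_eq_mul, mul_one] at h3
  unfold deg
  omega

/-- The finite set of exponent sequences `Q` with `deg p Q = d`. -/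
noncomputable def ofDeg (p d : ℕ) : Finset (ℕ →₀ ℕ) :=
  {Q ∈ Finset.Icc 0 (∑ i ∈ Finset.range d, Finsupp.single i d) | deg p Q = d}

theorem mem_ofDeg {p : ℕ} (hp : 0 < p) {d : ℕ} {Q : ℕ →₀ ℕ} : Q ∈ ofDeg p d ↔ deg p Q = d := by
  rw [ofDeg, Finset.mem_filter, and_iff_right_iff_imp, Finset.mem_Icc]
  rintro rfl
  refine ⟨zero_le, fun i => ?_⟩
  by_cases hi : i ∈ Q.support
  · rw [Finsupp.finsetSum_apply, Finset.sum_eq_single i, Finsupp.single_eq_same]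
    · exact apply_le_deg p Q i
    · intro j _ hj
      exact Finsupp.single_eq_of_ne hj.symm
    · exact fun h => absurd (Finset.mem_range.2 (lt_deg_of_mem_support hp hi)) h
  · rw [Finsupp.notMem_support_iff.1 hi]
    exact zero_le

/-- The sum of the Milnor basis operators `P(Q)` with `deg p Q = d`. -/
noncomputable def milnorSum (p d : ℕ) : Module.End (ZMod p) (Poly p) :=
  ∑ Q ∈ ofDeg p d, milnorOp p Q

theorem weight_le_deg {p : ℕ} (Q : ℕ →₀ ℕ) : Finsupp.weight (fun i => p ^ i) Q ≤ deg p Q := by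
  rw [deg_eq]; exact Nat.le_add_right _ _

theorem mul_weight_eq {p : ℕ} (hp : 0 < p) (Q : ℕ →₀ ℕ) :
    p * Finsupp.weight (fun i => p ^ i) Q = (p - 1) * deg p Q + Q.degree := by
  induction Q using finsupp_induction with
  | zero => simp
  | add Q Q' h h' => rw [map_add, mul_add, h, h', map_add, map_add]; ring
  | single i =>
    rw [Finsupp.weight_single, deg, Finsupp.weight_single, one_smul, one_smul,
      Finsupp.degree_single, mul_comm (p - 1), geom_sum_mul_of_one_le hp, ← pow_succ',
      Nat.sub_add_cancel (Nat.one_le_pow _ _ hp)]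

/-- Setting all `ξ_i` to `1` turns `∏ (ξ_{i+1} + ξ_i T^(p^i))^(Q i)` into
`∏ (1 + T^(p^i))^(Q i) = (1 + T)^(∑ p^i Q i)`. -/
theorem map_eval_one_thetaPow {p : ℕ} (hp : p.Prime) {n : ℕ} {Q : ℕ →₀ ℕ}
    (hQ : Q.support ⊆ Finset.range n) :
    (thetaPow p n Q).map (MvPolynomial.eval 1) =
      (1 + Polynomial.X) ^ Finsupp.weight (fun i => p ^ i) Q := by
  have := Fact.mk hp
  rw [thetaPow, ← Polynomial.coe_mapRingHom, map_finsuppProd, Finsupp.weight_apply,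
    Finsupp.sum, ← Finset.prod_pow_eq_pow_sum, Finsupp.prod]
  refine Finset.prod_congr rfl fun i hi => ?_
  rw [smul_eq_mul, mul_comm, pow_mul, add_pow_char_pow, one_pow, map_pow, theta,
    if_pos (Finset.mem_range.1 (hQ hi))]
  simp [MvPolynomial.eval_monomial]

theorem sum_coeff_thetaPow {p : ℕ} (hp : p.Prime) {n r e : ℕ} (hn : r + e ≤ n)
    (Q : ℕ →₀ ℕ) :
    ∑ S ∈ ofDeg p e, MvPolynomial.coeff S ((thetaPow p n Q).coeff r) =
      if deg p Q = r + e then ((Finsupp.weight (fun i => p ^ i) Q).choose r : ZMod p) else 0 := by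
  have hS : ∀ S, MvPolynomial.coeff S ((thetaPow p n Q).coeff r) ≠ 0 →
      deg p Q = r + deg p S := by
    intro S h
    obtain ⟨a, c, rfl, rfl, rfl⟩ := coeff_thetaPow_ne_zero p n Q r S h
    rw [map_add, map_add, deg_eq p c]; ring
  split_ifs with h
  · have hQ : Q.support ⊆ Finset.range n := fun i hi => by
      have := lt_deg_of_mem_support hp.pos hi
      exact Finset.mem_range.2 (by omega)
    have h1 := congrArg (Polynomial.coeff · r) (map_eval_one_thetaPow hp hQ)
    simp only [Polynomial.coeff_map, Polynomial.coeff_one_add_X_pow] at h1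
    rw [← h1, MvPolynomial.eval_eq]
    simp only [Pi.one_apply, one_pow, Finset.prod_const_one, mul_one]
    refine (Finset.sum_subset (fun S hS' => ?_) fun S _ hS' => ?_).symm
    · have := hS S (MvPolynomial.mem_support_iff.1 hS')
      exact (mem_ofDeg hp.pos).2 (by omega)
    · exact MvPolynomial.notMem_support_iff.1 hS'
  · refine Finset.sum_eq_zero fun S hS' => ?_
    by_contra hne
    exact h ((mem_ofDeg hp.pos).1 hS' ▸ hS S hne)

/-- The product `P^r · ∑_{deg S = e} P(S)` in the Milnor basis: the coefficient of `P(Q)` is a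
single binomial coefficient. -/
theorem powerOp_mul_milnorSum {p : ℕ} (hp : p.Prime) (r e : ℕ) :
    powerOp p r * milnorSum p e = ∑ Q ∈ ofDeg p (r + e),
      ((Finsupp.weight (fun i => p ^ i) Q).choose r : ZMod p) • milnorOp p Q := by
  refine LinearMap.ext fun f => ?_
  have hsub : ∀ {Q : ℕ →₀ ℕ} {d : ℕ}, Q ∈ ofDeg p d → Q.support ⊆ Finset.range d :=
    fun {Q d} hQ i hi =>
      Finset.mem_range.2 ((mem_ofDeg hp.pos).1 hQ ▸ lt_deg_of_mem_support hp.pos hi)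
  have h1 : ∀ S ∈ ofDeg p e, powerOp p r (milnorOp p S f) =
      ∑ Q ∈ (coactionTrunc p (r + e + 1) f).support,
        MvPolynomial.coeff S ((thetaPow p (r + e) Q).coeff r) •
          (coactionTrunc p (r + e + 1) f).coeff Q := fun S hS =>
    powerOp_milnorOp_apply hp _ r S ((hsub hS).trans (Finset.range_mono (Nat.le_add_left e r))) f
  rw [Module.End.mul_apply, milnorSum, LinearMap.sum_apply, map_sum, Finset.sum_congr rfl h1,
    Finset.sum_comm, LinearMap.sum_apply]
  simp only [← Finset.sum_smul, sum_coeff_thetaPow hp le_rfl, LinearMap.smul_apply]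
  refine Finset.sum_congr_of_eq_on_inter ?_ ?_ ?_
  · intro Q _ hQ
    rw [if_neg fun h => hQ ((mem_ofDeg hp.pos).2 h), zero_smul]
  · intro Q hQ hQ'
    rw [← coeff_coactionTrunc p (r + e + 1) f Q ((hsub hQ).trans
      (Finset.range_mono (Nat.le_succ _))), MvPolynomial.notMem_support_iff.1 hQ', smul_zero]
  · intro Q _ hQ
    rw [if_pos ((mem_ofDeg hp.pos).1 hQ), coeff_coactionTrunc p (r + e + 1) f Q
      ((hsub hQ).trans (Finset.range_mono (Nat.le_succ _)))]

theorem sum_neg_one_pow_mul_choose {w r : ℕ} (hw : 0 < w) (hwr : w ≤ r) :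
    ∑ k ∈ Finset.range (r + 1), ((-1) ^ k * w.choose k : ℤ) = 0 := by
  obtain ⟨v, rfl⟩ : ∃ v, w = v + 1 := ⟨w - 1, by omega⟩
  rw [Int.alternating_sum_range_choose_eq_choose, Nat.choose_eq_zero_of_lt (by omega),
    Nat.cast_zero, mul_zero]

/-- The alternating sum `∑_{i + j = r} P^i (-1)^j ∑_{deg S = j} P(S)` vanishes, because the
coefficient of `P(Q)` in it is an alternating sum of binomial coefficients. -/
theorem sum_powerOp_mul_milnorSum {p : ℕ} (hp : p.Prime) {r : ℕ} (hr : 0 < r) :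
    ∑ j ∈ Finset.range (r + 1), powerOp p (r - j) * ((-1 : ZMod p) ^ j • milnorSum p j) = 0 := by
  have h1 : ∀ j ∈ Finset.range (r + 1), powerOp p (r - j) * ((-1 : ZMod p) ^ j • milnorSum p j) =
      ∑ Q ∈ ofDeg p r, ((-1 : ZMod p) ^ j *
        ((Finsupp.weight (fun i => p ^ i) Q).choose (r - j) : ZMod p)) • milnorOp p Q := by
    intro j hj
    have hj' : r - j + j = r := Nat.sub_add_cancel (Nat.lt_succ_iff.1 (Finset.mem_range.1 hj))
    rw [mul_smul_comm, powerOp_mul_milnorSum hp, hj', Finset.smul_sum]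
    simp only [smul_smul]
  rw [Finset.sum_congr rfl h1, Finset.sum_comm]
  refine Finset.sum_eq_zero fun Q hQ => ?_
  have hQr := (mem_ofDeg hp.pos).1 hQ
  have hw : 0 < Finsupp.weight (fun i => p ^ i) Q := by
    have h4 := mul_weight_eq hp.pos Q
    rcases Nat.eq_zero_or_pos (Finsupp.weight (fun i => p ^ i) Q) with h0 | h0
    · have := Nat.mul_pos (Nat.sub_pos_of_lt hp.one_lt) hr
      rw [h0, hQr] at h4
      omega
    · exact h0
  have key := congrArg (Int.cast (R := ZMod p))
    (sum_neg_one_pow_mul_choose hw ((weight_le_deg Q).trans_eq hQr))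
  rw [← Finset.sum_smul, ← Finset.sum_range_reflect]
  have h5 : ∑ j ∈ Finset.range (r + 1), (-1 : ZMod p) ^ (r + 1 - 1 - j) *
      ((Finsupp.weight (fun i => p ^ i) Q).choose (r - (r + 1 - 1 - j)) : ZMod p) =
      (-1) ^ r * ∑ j ∈ Finset.range (r + 1), (-1 : ZMod p) ^ j *
        ((Finsupp.weight (fun i => p ^ i) Q).choose j : ZMod p) := by
    rw [Finset.mul_sum]
    refine Finset.sum_congr rfl fun j hj => ?_
    have hj' : j ≤ r := Nat.lt_succ_iff.1 (Finset.mem_range.1 hj)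
    have h6 : (-1 : ZMod p) ^ (r - j) = (-1) ^ r * (-1) ^ j := by
      obtain ⟨k, rfl⟩ := Nat.exists_eq_add_of_le hj'
      rw [Nat.add_sub_cancel_left, pow_add, mul_right_comm, ← mul_pow, neg_one_mul, neg_neg,
        one_pow, one_mul]
    rw [Nat.add_sub_cancel, Nat.sub_sub_self hj', h6, mul_assoc]
  push_cast at key
  rw [h5, key, mul_zero, zero_smul]

/-- Milnor's formula `χ(P^r) = (-1)^r ∑_{deg Q = r} P(Q)`. -/
theorem conj_eq_milnorSum {p : ℕ} (hp : p.Prime) (r : ℕ) :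
    (conj p r).1 = (-1 : ZMod p) ^ r • milnorSum p r := by
  induction r using Nat.strong_induction_on with
  | _ r ih =>
    rcases Nat.eq_zero_or_pos r with rfl | hr
    · have h0 : ofDeg p 0 = {0} := by
        ext Q
        rw [mem_ofDeg hp.pos, Finset.mem_singleton]
        refine ⟨fun h => (Finsupp.degree_eq_zero_iff Q).1 ?_, fun h => by rw [h, map_zero]⟩
        exact Nat.le_zero.1 (h ▸ degree_le_deg Q)
      rw [pow_zero, one_smul, milnorSum, h0, Finset.sum_singleton, milnorOp_zero, conj]
      rfl
    · have h1 := congrArg Subtype.val (sum_P_conj p hr)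
      have h2 := sum_powerOp_mul_milnorSum hp hr
      rw [Finset.sum_range_succ, Nat.sub_self, P_zero, one_mul] at h1
      rw [Finset.sum_range_succ, Nat.sub_self, powerOp_zero, one_mul] at h2
      have h3 : ∀ j ∈ Finset.range r, (P p (r - j) * conj p j).1 =
          powerOp p (r - j) * ((-1 : ZMod p) ^ j • milnorSum p j) := fun j hj =>
        congrArg (powerOp p (r - j) * ·) (ih j (Finset.mem_range.1 hj))
      rw [AddMemClass.coe_add, AddSubmonoidClass.coe_finsetSum, Finset.sum_congr rfl h3] at h1
      exact add_left_cancel (h1.trans h2.symm)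

theorem coe_hatP (p : ℕ) [Fact p.Prime] (r : ℕ) : (hatP p r).1 = milnorSum p r := by
  have h1 : ((-1) ^ r : steenrodAlgebra p) * conj p r = (-1 : ZMod p) ^ r • conj p r := by
    rw [Algebra.smul_def, map_pow, map_neg, map_one]
  rw [hatP, (chi_isAntipode p).apply_P, h1, Subalgebra.coe_smul, conj_eq_milnorSum Fact.out,
    smul_smul, ← mul_pow, neg_one_mul, neg_neg, one_pow, one_smul]

/-! ### Milnor basis elements on polynomials of low degree -/

theorem totalDegree_coactionTrunc_le (p n : ℕ) (f : Poly p) :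
    (coactionTrunc p n f).totalDegree ≤ f.totalDegree := by
  have hX : ∀ j, (coactionTrunc p n (MvPolynomial.X j)).totalDegree ≤ 1 := by
    intro j
    rw [coactionTrunc, MvPolynomial.aeval_X]
    refine (MvPolynomial.totalDegree_add _ _).trans (max_le (by simp) ?_)
    refine MvPolynomial.totalDegree_finsetSum_le fun i _ => ?_
    refine (MvPolynomial.totalDegree_mul _ _).trans ?_
    rw [MvPolynomial.totalDegree_C, zero_add]
    exact (MvPolynomial.totalDegree_monomial_le _ _).trans (by simp)
  rw [f.as_sum, map_sum]
  refine MvPolynomial.totalDegree_finsetSum_le fun m hm => ?_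
  rw [← f.as_sum]
  refine le_trans ?_ (MvPolynomial.le_totalDegree hm)
  rw [MvPolynomial.monomial_eq, map_mul, Finsupp.prod, map_prod, ← MvPolynomial.algebraMap_eq,
    AlgHom.commutes, IsScalarTower.algebraMap_apply (ZMod p) (Poly p) (MvPolynomial ℕ (Poly p))]
  refine (MvPolynomial.totalDegree_mul _ _).trans ?_
  rw [MvPolynomial.algebraMap_eq, MvPolynomial.totalDegree_C, zero_add]
  refine (MvPolynomial.totalDegree_finsetProd _ _).trans (Finset.sum_le_sum fun j _ => ?_)
  rw [map_pow]
  exact (MvPolynomial.totalDegree_pow _ _).trans ((Nat.mul_le_mul_left _ (hX j)).trans_eq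
    (mul_one _))

theorem milnorOp_eq_zero_of_totalDegree_lt {p : ℕ} {Q : ℕ →₀ ℕ} {f : Poly p}
    (h : f.totalDegree < Q.degree) : milnorOp p Q f = 0 := by
  rw [← coeff_coactionTrunc p (Q.support.sup id + 1) f Q fun i hi => Finset.mem_range.2
    (Nat.lt_succ_of_le (Finset.le_sup (f := id) hi))]
  exact MvPolynomial.coeff_eq_zero_of_totalDegree_lt
    ((totalDegree_coactionTrunc_le p _ f).trans_lt h)

/-! ### The sequence `(p - 1, …, p - 1, b)` -/

theorem milnorIndex_apply (p m b i : ℕ) : milnorIndex p (m + 1) b i =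
    if i < m then p - 1 else if i = m then b else 0 := by
  rw [milnorIndex, Nat.add_sub_cancel, Finsupp.add_apply, Finsupp.finsetSum_apply]
  simp only [Finsupp.single_apply, Finset.sum_ite_eq', Finset.mem_range, eq_comm (a := m)]
  split_ifs <;> omega

theorem shift_milnorIndex (p m b : ℕ) :
    shift (milnorIndex p (m + 2) b) = milnorIndex p (m + 1) b := by
  ext i
  rw [shift_apply, milnorIndex_apply, milnorIndex_apply]
  simp only [Nat.add_lt_add_iff_right, Nat.add_right_cancel_iff]

theorem milnorIndex_one (p b : ℕ) : milnorIndex p 1 b = Finsupp.single 0 b := by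
  simp [milnorIndex]

theorem shift_single_zero_eq_zero (b : ℕ) : shift (Finsupp.single 0 b) = 0 := by
  ext i
  simp [shift_apply]

theorem weight_milnorIndex {p : ℕ} (hp : 0 < p) (m b : ℕ) :
    Finsupp.weight (fun i => p ^ i) (milnorIndex p (m + 1) b) + 1 = (b + 1) * p ^ m := by
  induction m with
  | zero => simp [milnorIndex_one, Finsupp.weight_single]
  | succ m ih =>
    rw [weight_eq, shift_milnorIndex, milnorIndex_apply, if_pos m.succ_pos, add_right_comm,
      Nat.sub_add_cancel hp, ← mul_one_add p, add_comm 1, ih]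
    ring

theorem degree_milnorIndex (p m b : ℕ) :
    (milnorIndex p (m + 1) b).degree = m * (p - 1) + b := by
  induction m with
  | zero => simp [milnorIndex_one]
  | succ m ih =>
    rw [degree_eq, shift_milnorIndex, ih, milnorIndex_apply, if_pos m.succ_pos]
    ring

theorem pnum_eq_sum {p : ℕ} (hp : 2 ≤ p) (n : ℕ) : pnum p n = ∑ k ∈ Finset.range n, p ^ k :=
  (Nat.geomSum_eq hp n).symm

theorem pnum_succ {p : ℕ} (hp : 2 ≤ p) (n : ℕ) : pnum p (n + 1) = p ^ n + pnum p n := by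
  rw [pnum_eq_sum hp, pnum_eq_sum hp, Finset.sum_range_succ, add_comm]

theorem pred_mul_pnum {p : ℕ} (hp : 2 ≤ p) (n : ℕ) : (p - 1) * pnum p n + 1 = p ^ n := by
  rw [pnum_eq_sum hp, mul_comm, geom_sum_mul_of_one_le (by omega),
    Nat.sub_add_cancel (Nat.one_le_pow _ _ (by omega))]

theorem deg_milnorIndex {p : ℕ} (hp : 2 ≤ p) (m b : ℕ) :
    deg p (milnorIndex p (m + 1) b) + (m + 1) = (b + 1) * pnum p (m + 1) := by
  induction m with
  | zero => simp [milnorIndex_one, deg, Finsupp.weight_single, pnum_eq_sum hp]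
  | succ m ih =>
    have h := weight_milnorIndex (by omega : 0 < p) (m + 1) b
    rw [deg_eq, shift_milnorIndex, pnum_succ hp, mul_add, ← ih, ← h]
    ring

/-- Among the sequences `Q` with `∑ p^i Q i = (b + 1) p^m - 1 - k`, the sum of the entries is at
least `m (p - 1) + b - k`; for `k = 0` the base `p` digits `(p - 1, …, p - 1, b)` are the only
minimal sequence. -/
theorem le_degree_add_of_weight_add_eq {p b : ℕ} (hp : 2 ≤ p) (hb : b ≤ p - 1) (m : ℕ) :
    ∀ (k : ℕ) (Q : ℕ →₀ ℕ), Finsupp.weight (fun i => p ^ i) Q + k + 1 = (b + 1) * p ^ m →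
      m * (p - 1) + b ≤ Q.degree + k ∧
        (k = 0 → Q.degree ≤ m * (p - 1) + b → Q = milnorIndex p (m + 1) b) := by
  induction m with
  | zero =>
    intro k Q h
    have h1 := weight_eq p Q
    have h2 : Finsupp.weight (fun i => p ^ i) (shift Q) = 0 := by
      by_contra hne
      have := Nat.mul_le_mul_left p (Nat.one_le_iff_ne_zero.2 hne)
      rw [pow_zero] at h
      omega
    have h3 : (shift Q).degree = 0 :=
      Nat.le_zero.1 (h2 ▸ degree_le_weight (by omega : 0 < p) (shift Q))
    have h4 := degree_eq Q
    rw [h2, mul_zero, add_zero] at h1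
    rw [pow_zero, mul_one] at h
    refine ⟨by omega, fun hk _ => Finsupp.ext fun i => ?_⟩
    rw [milnorIndex_apply, if_neg i.not_lt_zero]
    cases i with
    | zero => rw [if_pos rfl]; omega
    | succ i =>
      rw [if_neg i.succ_ne_zero, ← shift_apply, (Finsupp.degree_eq_zero_iff _).1 h3,
        Finsupp.zero_apply]
  | succ m ih =>
    intro k Q h
    rw [weight_eq, pow_succ] at h
    have hlt : Finsupp.weight (fun i => p ^ i) (shift Q) < (b + 1) * p ^ m := by
      refine Nat.lt_of_mul_lt_mul_left (a := p) ?_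
      have : p * ((b + 1) * p ^ m) = (b + 1) * (p ^ m * p) := by ring
      omega
    obtain ⟨k', hk'⟩ := Nat.exists_eq_add_of_lt hlt
    obtain ⟨h1, h2⟩ := ih k' (shift Q) hk'.symm
    have h3 := degree_eq Q
    have h4 : Q 0 + k + 1 = p * k' + p := by
      have : p * ((b + 1) * p ^ m) = (b + 1) * (p ^ m * p) := by ring
      rw [hk'] at this
      have h5 : p * (Finsupp.weight (fun i => p ^ i) (shift Q) + k' + 1) =
        p * Finsupp.weight (fun i => p ^ i) (shift Q) + p * k' + p := by ring
      omega
    have h6 : (m + 1) * (p - 1) = m * (p - 1) + (p - 1) := by ring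
    have h7 : 2 * k' ≤ p * k' := Nat.mul_le_mul_right k' hp
    refine ⟨by omega, fun hk hQ => ?_⟩
    have hk0 : k' = 0 := by omega
    rw [hk0, mul_zero] at h4
    have h8 := h2 hk0 (by omega)
    ext i
    cases i with
    | zero => rw [milnorIndex_apply, if_pos m.succ_pos]; omega
    | succ i => rw [← shift_apply, ← shift_apply, h8, shift_milnorIndex]

/-- A sequence of the same degree as `(p - 1, …, p - 1, b)` but different from it has a larger
weight: if the weight drops by `k`, then the sum of the entries drops by `p k`, whereas
subtracting `k` from a number lowers its base `p` digit sum by at most `k`. -/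
theorem eq_milnorIndex_or_le_weight {p b : ℕ} (hp : 2 ≤ p) (hb : b ≤ p - 1) {m : ℕ} {Q : ℕ →₀ ℕ}
    (hQ : deg p Q = deg p (milnorIndex p (m + 1) b)) :
    Q = milnorIndex p (m + 1) b ∨ (b + 1) * p ^ m ≤ Finsupp.weight (fun i => p ^ i) Q := by
  by_contra! hne
  obtain ⟨k, hk⟩ := Nat.exists_eq_add_of_lt hne.2
  obtain ⟨h1, h2⟩ := le_degree_add_of_weight_add_eq hp hb m k Q hk.symm
  have h3 := mul_weight_eq (by omega : 0 < p) Q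
  have h4 := mul_weight_eq (by omega : 0 < p) (milnorIndex p (m + 1) b)
  have h5 : Finsupp.weight (fun i => p ^ i) (milnorIndex p (m + 1) b) =
      Finsupp.weight (fun i => p ^ i) Q + k := by
    have := weight_milnorIndex (by omega : 0 < p) m b
    omega
  rw [h5, mul_add, degree_milnorIndex, ← hQ] at h4
  have h6 : 2 * k ≤ p * k := Nat.mul_le_mul_right k hp
  exact hne.1 (h2 (by omega) (by omega))

theorem lt_degree_of_ne_milnorIndex {p b : ℕ} (hp : 2 ≤ p) (hb : b ≤ p - 1) {m : ℕ} {Q : ℕ →₀ ℕ}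
    (hQ : deg p Q = deg p (milnorIndex p (m + 1) b)) (hne : Q ≠ milnorIndex p (m + 1) b) :
    (m + 1) * (p - 1) + b < Q.degree := by
  have h1 := (eq_milnorIndex_or_le_weight hp hb hQ).resolve_left hne
  have h2 := weight_milnorIndex (by omega : 0 < p) m b
  have h3 := mul_weight_eq (by omega : 0 < p) Q
  have h4 := mul_weight_eq (by omega : 0 < p) (milnorIndex p (m + 1) b)
  have h5 := Nat.mul_le_mul_left p (h2.trans_le h1)
  rw [mul_add, h3, h4, hQ, degree_milnorIndex] at h5
  have h6 : (m + 1) * (p - 1) = m * (p - 1) + (p - 1) := by ring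
  omega

/-! ### Binomial coefficients modulo `p` -/

theorem choose_mul_pow_modEq {p : ℕ} [Fact p.Prime] (c m w : ℕ) :
    w.choose (c * p ^ m) ≡ (w / p ^ m).choose c [MOD p] := by
  induction m generalizing w with
  | zero => simp [Nat.ModEq.refl]
  | succ m ih =>
    have hp : 0 < p := (Fact.out : p.Prime).pos
    have h := Choose.choose_modEq_choose_mod_mul_choose_div_nat (n := w) (k := c * p ^ (m + 1))
      (p := p)
    have h1 : c * p ^ (m + 1) = p * (c * p ^ m) := by ring
    rw [h1, Nat.mul_mod_right, Nat.mul_div_cancel_left _ hp, Nat.choose_zero_right, one_mul] at h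
    rw [h1, pow_succ', ← Nat.div_div_eq_div_mul]
    exact h.trans (ih _)

theorem cast_choose_mul_pow_eq_one {p : ℕ} [Fact p.Prime] {c m w : ℕ} (h1 : c * p ^ m ≤ w)
    (h2 : w < (c + 1) * p ^ m) : (w.choose (c * p ^ m) : ZMod p) = 1 := by
  have h3 : w / p ^ m = c := Nat.div_eq_of_lt_le h1 h2
  have h := choose_mul_pow_modEq (p := p) c m w
  rw [h3, Nat.choose_self] at h
  simpa using (ZMod.natCast_eq_natCast_iff _ _ _).2 h

theorem cast_choose_eq_one_of_le_deg {p b : ℕ} [Fact p.Prime] (hb : b ≤ p - 1) {m w : ℕ}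
    (h1 : (b + 1) * p ^ m ≤ w) (h2 : w ≤ deg p (milnorIndex p (m + 1) b)) :
    (w.choose ((b + 1) * p ^ m) : ZMod p) = 1 := by
  have hp : 2 ≤ p := (Fact.out : p.Prime).two_le
  have h3 := deg_milnorIndex hp m b
  rcases Nat.lt_or_ge (b + 1) p with hlt | hge
  · refine cast_choose_mul_pow_eq_one h1 ?_
    have h4 := pred_mul_pnum hp m
    have h5 : (b + 1) * pnum p m ≤ (p - 1) * pnum p m := Nat.mul_le_mul_right _ (by omega)
    rw [pnum_succ hp, mul_add] at h3
    rw [add_one_mul]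
    omega
  · -- Here `(b + 1) p ^ m = p ^ (m + 1)` and the relevant digit has index `m + 1`.
    have hbp : b + 1 = p := by omega
    have h4 := pred_mul_pnum hp (m + 1)
    have h5 : p * pnum p (m + 1) ≤ 2 * (p - 1) * pnum p (m + 1) :=
      Nat.mul_le_mul_right _ (by omega)
    rw [mul_assoc] at h5
    have h6 : p * p ^ m = 1 * p ^ (m + 1) := by ring
    rw [hbp, h6] at h1 ⊢
    rw [hbp] at h3
    exact cast_choose_mul_pow_eq_one h1 (by omega)

/-- If the last base `p` digit of `c` is `p - 1`, then adding a non-zero digit `a` to `c` produces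
a carry. -/
theorem eq_zero_of_cast_choose_add_ne_zero {p a c : ℕ} [Fact p.Prime] (hc : p ∣ c + 1)
    (ha : a < p) (h : ((a + c).choose c : ZMod p) ≠ 0) : a = 0 := by
  by_contra hne
  obtain ⟨d, rfl⟩ := Nat.exists_eq_succ_of_ne_zero hne
  refine h ((ZMod.natCast_eq_zero_iff _ _).2 ?_)
  have h1 := Nat.choose_succ_right_eq (d + 1 + c) d
  rw [← Nat.choose_symm_add]
  rw [show d + 1 + c - d = c + 1 by omega] at h1
  have h2 : p ∣ (d + 1 + c).choose (d + 1) * (d + 1) := h1 ▸ hc.mul_left _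
  exact ((Fact.out : p.Prime).dvd_mul.1 h2).resolve_right (Nat.not_dvd_of_pos_of_lt d.succ_pos ha)

/-! ### Factorization of `P(p - 1, …, p - 1, b)` -/

theorem eq_zero_of_shift_milnorIndex_eq {p b m : ℕ} [Fact p.Prime] (hb : b ≤ p - 1)
    {a c : ℕ →₀ ℕ} (hS : shift (milnorIndex p (m + 1) b) = a + shift c)
    (hr : Finsupp.weight (fun i => p ^ i) (milnorIndex p (m + 1) b) =
      Finsupp.weight (fun i => p ^ i) c)
    (hc : ∀ i, ((a i + c i).choose (c i) : ZMod p) ≠ 0) : a = 0 := by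
  have hp : 2 ≤ p := (Fact.out : p.Prime).two_le
  have hS' : ∀ i, milnorIndex p (m + 1) b (i + 1) = a i + c (i + 1) := fun i =>
    DFunLike.congr_fun hS i
  have ha : ∀ i, a i < p := fun i => by
    have h1 := hS' i
    rw [milnorIndex_apply] at h1
    split_ifs at h1 <;> omega
  have key : ∀ i < m, p ∣ c i + 1 := by
    intro i hi
    induction i with
    | zero =>
      have h1 := weight_milnorIndex (by omega : 0 < p) m b
      have h2 : p ∣ (b + 1) * p ^ m := (dvd_pow_self p (by omega)).mul_left _
      rw [← h1, hr, weight_eq, add_right_comm] at h2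
      exact (Nat.dvd_add_left (Dvd.intro _ rfl)).1 h2
    | succ i ih =>
      have h1 := eq_zero_of_cast_choose_add_ne_zero (ih (by omega)) (ha i) (hc i)
      have h2 := hS' i
      rw [milnorIndex_apply, if_pos hi, h1, zero_add] at h2
      rw [← h2, Nat.sub_add_cancel (by omega)]
  ext i
  rcases Nat.lt_or_ge i m with hi | hi
  · exact eq_zero_of_cast_choose_add_ne_zero (key i hi) (ha i) (hc i)
  · have h1 := hS' i
    rw [milnorIndex_apply, if_neg (by omega), if_neg (by omega)] at h1
    rw [Finsupp.zero_apply]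
    omega

theorem powerOp_mul_milnorOp_milnorIndex {p b : ℕ} [Fact p.Prime] (hb : b ≤ p - 1) (m : ℕ) :
    powerOp p ((b + 1) * p ^ m - 1) * milnorOp p (shift (milnorIndex p (m + 1) b)) =
      milnorOp p (milnorIndex p (m + 1) b) := by
  have hp : p.Prime := Fact.out
  have h := weight_milnorIndex hp.pos m b
  rw [← h, Nat.add_sub_cancel]
  exact powerOp_mul_milnorOp_shift hp _ fun a c hS hr hc =>
    eq_zero_of_shift_milnorIndex_eq hb hS hr hc

theorem exponents_succ (p n b : ℕ) :
    exponents p (n + 1) b = ((b + 1) * p ^ n - 1) :: exponents p n b := by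
  simp [exponents, List.range_succ]

theorem milnor_milnorIndex {p b : ℕ} [Fact p.Prime] (hb : b ≤ p - 1) (m : ℕ) :
    milnor p (milnorIndex p (m + 1) b) = powerMonomial p (exponents p (m + 1) b) := by
  have h : milnor p (milnorIndex p (m + 1) b) = P p ((b + 1) * p ^ m - 1) *
      milnor p (shift (milnorIndex p (m + 1) b)) :=
    Subtype.ext (powerOp_mul_milnorOp_milnorIndex hb m).symm
  rw [h, exponents_succ, powerMonomial, List.map_cons, List.prod_cons]
  congr 1
  cases m with
  | zero =>
    rw [milnorIndex_one, shift_single_zero_eq_zero]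
    exact Subtype.ext (milnorOp_zero p)
  | succ m => rw [shift_milnorIndex]; exact milnor_milnorIndex hb m

theorem isAdmissible_exponents {p b : ℕ} (hp : 2 ≤ p) (hb : 1 ≤ b) (n : ℕ) :
    IsAdmissible p (exponents p n b) := by
  induction n with
  | zero => exact ⟨by simp [exponents], by simp [exponents]⟩
  | succ n ih =>
    have hpos : 1 ≤ p ^ n := Nat.one_le_pow _ _ (by omega)
    refine ⟨?_, ?_⟩
    · cases n with
      | zero => simp [exponents]
      | succ n =>
        have h := ih.1
        rw [exponents_succ] at h ⊢
        rw [exponents_succ, List.isChain_cons_cons]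
        refine ⟨?_, h⟩
        rw [Nat.mul_sub, mul_one, pow_succ', mul_left_comm]
        exact Nat.sub_le_sub_left (by omega) _
    · intro s hs
      rw [exponents_succ, List.mem_cons] at hs
      rcases hs with rfl | hs
      · have := Nat.mul_le_mul (by omega : 2 ≤ b + 1) hpos
        omega
      · exact ih.2 s hs

/-! ### Conjugate powers and `P(p - 1, …, p - 1, b)` -/

theorem hatP_apply_eq_milnor_apply {p b : ℕ} [Fact p.Prime] (hb : b ≤ p - 1) (m : ℕ) (g : Poly p)
    (hg : g.totalDegree ≤ (m + 1) * (p - 1) + b) :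
    (hatP p (deg p (milnorIndex p (m + 1) b))).1 g = (milnor p (milnorIndex p (m + 1) b)).1 g := by
  have hp : p.Prime := Fact.out
  rw [coe_hatP, milnorSum, LinearMap.sum_apply,
    Finset.sum_eq_single_of_mem _ ((mem_ofDeg hp.pos).2 rfl)]
  · rfl
  · intro Q hQ hne
    exact milnorOp_eq_zero_of_totalDegree_lt (hg.trans_lt
      (lt_degree_of_ne_milnorIndex hp.two_le hb ((mem_ofDeg hp.pos).1 hQ) hne))

/-- The sum of all `P(Q)` of the degree of `(p - 1, …, p - 1, b)`, except for that sequence itself,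
is a product: the binomial coefficients of the product formula are `0` for the excluded sequence
and `1` for all others. -/
theorem powerOp_mul_milnorSum_eq_sum_erase {p b : ℕ} [Fact p.Prime] (hb : b ≤ p - 1) {m e : ℕ}
    (he : (b + 1) * p ^ m + e = deg p (milnorIndex p (m + 1) b)) :
    powerOp p ((b + 1) * p ^ m) * milnorSum p e =
      ∑ Q ∈ (ofDeg p (deg p (milnorIndex p (m + 1) b))).erase (milnorIndex p (m + 1) b),
        milnorOp p Q := by
  have hp : p.Prime := Fact.out
  have hw := weight_milnorIndex hp.pos m b
  rw [powerOp_mul_milnorSum hp, he, ← Finset.add_sum_erase _ _ ((mem_ofDeg hp.pos).2 rfl),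
    Nat.choose_eq_zero_of_lt (Nat.lt_of_succ_le hw.le), Nat.cast_zero, zero_smul, zero_add]
  refine Finset.sum_congr rfl fun Q hQ => ?_
  obtain ⟨hne, hQ⟩ := Finset.mem_erase.1 hQ
  have hdeg := (mem_ofDeg hp.pos).1 hQ
  rw [cast_choose_eq_one_of_le_deg hb
    ((eq_milnorIndex_or_le_weight hp.two_le hb hdeg).resolve_left hne)
    ((weight_le_deg Q).trans_eq hdeg), one_smul]

theorem hatP_eq_P_mul_hatP_add_milnor {p b : ℕ} [Fact p.Prime] (hb : b ≤ p - 1) {m e : ℕ}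
    (he : (b + 1) * p ^ m + e = deg p (milnorIndex p (m + 1) b)) :
    hatP p (deg p (milnorIndex p (m + 1) b)) =
      P p ((b + 1) * p ^ m) * hatP p e + milnor p (milnorIndex p (m + 1) b) := by
  have hp : p.Prime := Fact.out
  have h : (milnor p (milnorIndex p (m + 1) b)).1 = milnorOp p (milnorIndex p (m + 1) b) := rfl
  have h' : (P p ((b + 1) * p ^ m)).1 = powerOp p ((b + 1) * p ^ m) := rfl
  refine Subtype.ext ?_
  rw [AddMemClass.coe_add, MulMemClass.coe_mul, coe_hatP, coe_hatP, h, h',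
    powerOp_mul_milnorSum_eq_sum_erase hb he, milnorSum,
    Finset.sum_erase_add _ _ ((mem_ofDeg hp.pos).2 rfl)]

end PthPowers

theorem mainTheorem10 (p : ℕ) [Fact p.Prime] (hp : p ≠ 2) (b : ℕ) (hb : 1 ≤ b) (hbp : b ≤ p - 1) :
    (∀ n : ℕ, 1 ≤ n →
      PthPowers.IsAdmissible p (PthPowers.exponents p n b) ∧
      PthPowers.milnor p (PthPowers.milnorIndex p n b) =
        PthPowers.powerMonomial p (PthPowers.exponents p n b)) ∧
    (∀ n : ℕ, 1 ≤ n → ∀ g : PthPowers.Poly p, g.totalDegree ≤ n * (p - 1) + b →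
      (PthPowers.hatP p ((b + 1) * PthPowers.pnum p n - n)).1 g =
        (PthPowers.milnor p (PthPowers.milnorIndex p n b)).1 g) ∧
    (∀ n : ℕ, 2 ≤ n →
      PthPowers.hatP p ((b + 1) * PthPowers.pnum p n - n) =
        PthPowers.P p ((b + 1) * p ^ (n - 1)) *
            PthPowers.hatP p ((b + 1) * PthPowers.pnum p (n - 1) - n) +
          PthPowers.milnor p (PthPowers.milnorIndex p n b)) := by
  have hp2 : 2 ≤ p := (Fact.out : p.Prime).two_le
  have hdeg : ∀ m, (b + 1) * PthPowers.pnum p (m + 1) - (m + 1) =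
      PthPowers.deg p (PthPowers.milnorIndex p (m + 1) b) := fun m => by
    rw [← PthPowers.deg_milnorIndex hp2, Nat.add_sub_cancel]
  refine ⟨fun n hn => ?_, fun n hn g hg => ?_, fun n hn => ?_⟩
  · obtain ⟨m, rfl⟩ := Nat.exists_eq_add_of_le' hn
    exact ⟨PthPowers.isAdmissible_exponents hp2 hb _, PthPowers.milnor_milnorIndex hbp m⟩
  · obtain ⟨m, rfl⟩ := Nat.exists_eq_add_of_le' hn
    rw [hdeg]
    exact PthPowers.hatP_apply_eq_milnor_apply hbp m g hg
  · obtain ⟨m, rfl⟩ := Nat.exists_eq_add_of_le' hn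
    rw [hdeg (m + 1)]
    refine PthPowers.hatP_eq_P_mul_hatP_add_milnor hbp ?_
    rw [← hdeg (m + 1), PthPowers.pnum_succ hp2 (m + 1), mul_add]
    -- The subtraction in the index of the second factor does not truncate, as `b` is positive.
    have h1 : ∑ k ∈ Finset.range (m + 1), 1 ≤ PthPowers.pnum p (m + 1) := by
      rw [PthPowers.pnum_eq_sum hp2]
      exact Finset.sum_le_sum fun k _ => Nat.one_le_pow _ _ (by omega)
    have h2 := Nat.mul_le_mul (by omega : 2 ≤ b + 1) h1
    simp only [Finset.sum_const, Finset.card_range, smul_eq_mul, mul_one] at h2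
    change (b + 1) * p ^ (m + 1) + ((b + 1) * PthPowers.pnum p (m + 1) - (m + 1 + 1)) = _
    omega
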